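/- Let $d_0=184$, the discriminant of the real quadratic field $K=\mathbb{Q}(\sqrt{184})=\mathbb{Q}(\sqrt{46})$. For an integer $f\ge 1$ let $\mathcal{O}_f=\mathbb{Z}\bigl[1,f\tfrac{d_0+\sqrt{d_0}}{2}\bigr]$ be the order of conductor $f$ in $K$ (so $\mathcal{O}_1$ is the maximal order), and define: - $h(d_0f^2)$, the number of classes of invertible fractional ideals of $\mathcal{O}_f$ modulo principal fractional ideals; - $h_+(d_0f^2)$, the number of classes of invertible fractional ideals of $\mathcal{O}_f$ modulo principal fractional ideals generated by a totally positive element of $K$ (one that is positive under both embeddings $K\to\mathbb{R}$); - $H(d)$, for a positive nonsquare discriminant $d$, the number of $SL(2,\mathbb{Z})$-equivalence classes of integral binary quadratic forms $ax^2+bxy+cy^2$ with $\gcd(a,b,c)=1$ and $b^2-4ac=d$. Then for every integer $f>1$, $$\frac{h(184f^2)}{h(184)}=\frac{h_+(184f^2)}{h_+(184)}=\frac{H(184f^2)}{H(184)}>1 .$$ In particular, no order $\mathcal{O}_f$ with $f>1$ has relative ideal class number $h(184f^2)/h(184)$ equal to one. -/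

import Mathlib

open scoped nonZeroDivisors

noncomputable section

/-! ### Orders of real quadratic fields -/

/-- For a positive fundamental discriminant `d₀`, the order `ℤ[1, f (d₀ + √d₀) / 2]` of conductor
`f ≥ 1` in the real quadratic field `ℚ(√d₀) ⊆ ℝ`; for `f = 1` it is the maximal order. -/
def quadOrder (d₀ f : ℕ) : Subalgebra ℤ ℝ :=
  Algebra.adjoin ℤ {(f : ℝ) * (((d₀ : ℝ) + √(d₀ : ℝ)) / 2)}

/-! ### Ideal class numbers -/

/-- The totally positive elements of a (totally real) field `K`: those that are positive under
every embedding of `K` into `ℝ`, as a subgroup of `Kˣ`. -/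
def totallyPositive (K : Type*) [Field K] : Subgroup Kˣ where
  carrier := {x | ∀ σ : K →+* ℝ, 0 < σ (x : K)}
  one_mem' σ := by simp
  mul_mem' {x y} hx hy σ := by
    rw [Units.val_mul, map_mul]
    exact mul_pos (hx σ) (hy σ)
  inv_mem' {x} hx σ := by
    rw [Units.val_inv_eq_inv_val, map_inv₀]
    exact inv_pos.mpr (hx σ)

/-- The strict (narrow) class group of a domain: the invertible fractional ideals modulo the
principal fractional ideals that have a totally positive generator. -/
abbrev StrictClassGroup (R : Type*) [CommRing R] [IsDomain R] : Type _ :=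
  (FractionalIdeal R⁰ (FractionRing R))ˣ ⧸
    (totallyPositive (FractionRing R)).map (toPrincipalIdeal R (FractionRing R))

/-- The ideal class number `h(d₀ f²)`: the number of classes of invertible ideals of the order of
conductor `f`, modulo principal ideals. -/
def idealClassNumber (d₀ f : ℕ) : ℕ := Nat.card (ClassGroup (quadOrder d₀ f))

/-- The strict ideal class number `h₊(d₀ f²)`. -/
def strictIdealClassNumber (d₀ f : ℕ) : ℕ := Nat.card (StrictClassGroup (quadOrder d₀ f))

/-! ### Form class numbers -/

/-- An integral binary quadratic form `a x² + b x y + c y²`. -/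
@[ext]
structure BinaryForm where
  a : ℤ
  b : ℤ
  c : ℤ

namespace BinaryForm

/-- The value `Q(x, y)`. -/
def eval (Q : BinaryForm) (x y : ℤ) : ℤ := Q.a * x ^ 2 + Q.b * x * y + Q.c * y ^ 2

/-- The discriminant `b² - 4 a c`. -/
def disc (Q : BinaryForm) : ℤ := Q.b ^ 2 - 4 * Q.a * Q.c

/-- Properly primitive forms: `gcd(a, b, c) = 1`. -/
def IsPrimitive (Q : BinaryForm) : Prop := Int.gcd (Int.gcd Q.a Q.b) Q.c = 1

/-- Proper equivalence: the forms agree up to a change of variables in `SL(2, ℤ)`. -/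
def ProperlyEquivalent (Q Q' : BinaryForm) : Prop :=
  ∃ γ : Matrix.SpecialLinearGroup (Fin 2) ℤ, ∀ x y : ℤ,
    Q'.eval x y = Q.eval (γ 0 0 * x + γ 0 1 * y) (γ 1 0 * x + γ 1 1 * y)

theorem properlyEquivalent_equivalence : Equivalence ProperlyEquivalent where
  refl Q := ⟨1, fun x y => by simp⟩
  symm := by
    rintro Q Q' ⟨γ, h⟩
    refine ⟨γ⁻¹, fun x y => ?_⟩
    have hd : γ 0 0 * γ 1 1 - γ 0 1 * γ 1 0 = 1 := by
      rw [← Matrix.det_fin_two]; exact γ.det_coe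
    have e : ∀ u v : ℤ, γ⁻¹ 0 0 * u + γ⁻¹ 0 1 * v = γ 1 1 * u - γ 0 1 * v ∧
        γ⁻¹ 1 0 * u + γ⁻¹ 1 1 * v = γ 0 0 * v - γ 1 0 * u := by
      intro u v
      rw [Matrix.SpecialLinearGroup.SL2_inv_expl]
      constructor <;> simp <;> ring
    rw [(e x y).1, (e x y).2, h]
    congr 1
    · linear_combination (-x) * hd
    · linear_combination (-y) * hd
  trans := by
    rintro Q Q' Q'' ⟨γ, h⟩ ⟨δ, k⟩
    refine ⟨γ * δ, fun x y => ?_⟩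
    rw [k, h]
    simp only [Matrix.SpecialLinearGroup.coe_mul, Matrix.mul_apply, Fin.sum_univ_two]
    congr 1 <;> ring

/-- Proper equivalence on the properly primitive forms of discriminant `d`. -/
def formSetoid (d : ℤ) : Setoid {Q : BinaryForm // Q.IsPrimitive ∧ Q.disc = d} :=
  Setoid.comap Subtype.val ⟨ProperlyEquivalent, properlyEquivalent_equivalence⟩

end BinaryForm

/-- The quadratic form class number `H(d)` of a positive nonsquare discriminant `d`: the number of
proper equivalence classes of properly primitive forms of discriminant `d`. -/
def formClassNumber (d : ℤ) : ℕ := Nat.card (Quotient (BinaryForm.formSetoid d))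

/-! ### Relative class numbers -/

/-- The relative ideal class number `h(d₀ f²) / h(d₀)`. -/
def relIdealClassNumber (d₀ f : ℕ) : ℚ :=
  (idealClassNumber d₀ f : ℚ) / (idealClassNumber d₀ 1 : ℚ)

/-- The relative strict ideal class number `h₊(d₀ f²) / h₊(d₀)`. -/
def relStrictIdealClassNumber (d₀ f : ℕ) : ℚ :=
  (strictIdealClassNumber d₀ f : ℚ) / (strictIdealClassNumber d₀ 1 : ℚ)

/-- The relative quadratic form class number `H(d₀ f²) / H(d₀)`. -/
def relFormClassNumber (d₀ f : ℕ) : ℚ :=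
  (formClassNumber ((d₀ : ℤ) * (f : ℤ) ^ 2) : ℚ) / (formClassNumber (d₀ : ℤ) : ℚ)

end

open scoped nonZeroDivisors

/-! ### Quadratic orders with two real embeddings -/

/-! The order of conductor `f` is `ℤ[√(46 f²)]`. As 23 divides 46 and -1 is not a square modulo 23,
it has no unit of norm -1, so `h₊ = 2h` for every `f` (`card_strictClassGroup_eq_two_mul`). The
classical dictionary between oriented lattices and norm forms gives `h₊ = H`
(`card_strictClassGroup`). Hence the three ratios agree, and what remains is `H(184) ≤ 2 < H(184
f²)` for `f > 1`.

The upper bound is reduction theory: every reduced form of discriminant 184 takes a value ±1, hence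
is equivalent to `±(x² - 46y²)`. For the lower bound, `±(x² - 46f²y²)` and `(tx + fy)² - 46x²` are
pairwise inequivalent for a suitable `t` (`two_lt_formClassNumber_of`). Write `f = 23^b m` with `23
∤ m`. For `m ≠ 1` a congruence modulo 8 or modulo an odd prime factor of `m` supplies `t`. For `m =
1` the special feature of 46 enters: 23 divides `y` in every solution of `x² - 46y² = 1`
(`dvd_y_of_fortySix`). -/

/-- A presentation of `R` as the order `ℤ[ω]`, `ω² = N`, with the two embeddings of its fraction
field `K` into `ℝ`. -/
structure RealQuadraticOrder (N : ℤ) (R K : Type*) [CommRing R] [Field K] [Algebra R K] where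
  /-- The square root of `N` that generates the order. -/
  ω : R
  /-- The embedding that sends `ω` to `√N`. -/
  σ₁ : K →+* ℝ
  /-- The embedding that sends `ω` to `-√N`. -/
  σ₂ : K →+* ℝ
  ω_mul_self : ω * ω = (N : R)
  exists_coord : ∀ r : R, ∃ x y : ℤ, r = x + y * ω
  σ₁_ω : σ₁ (algebraMap R K ω) = √(N : ℝ)
  σ₂_ω : σ₂ (algebraMap R K ω) = -√(N : ℝ)
  pos : 0 < N
  not_isSquare : ¬ IsSquare N

namespace RealQuadraticOrder

variable {N : ℤ} {R K : Type*} [CommRing R] [Field K] [Algebra R K]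
  (O : RealQuadraticOrder N R K)

theorem sqrt_pos (O : RealQuadraticOrder N R K) : 0 < √(N : ℝ) :=
  Real.sqrt_pos.mpr (by exact_mod_cast O.pos)

theorem sqrt_mul_sqrt (O : RealQuadraticOrder N R K) : √(N : ℝ) * √(N : ℝ) = N :=
  Real.mul_self_sqrt (by exact_mod_cast O.pos.le)

theorem sqrt_ne_intCast (O : RealQuadraticOrder N R K) (p : ℤ) : √(N : ℝ) ≠ p := by
  intro h
  have h2 := O.sqrt_mul_sqrt
  rw [h] at h2
  exact O.not_isSquare ⟨p, by exact_mod_cast h2.symm⟩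

theorem algebraMap_ω_ne_zero : algebraMap R K O.ω ≠ 0 := by
  intro h
  have := O.σ₁_ω
  rw [h, map_zero] at this
  exact O.sqrt_pos.ne this

/-! ### The ideals represented by a form -/

/-- The lattice `I` has a positively oriented basis for which the norm form, suitably scaled,
is `Q`. -/
def Represents (I : FractionalIdeal R⁰ K) (Q : BinaryForm) : Prop :=
  ∃ (u v : K) (κ : ℝ), 0 < κ ∧ (∀ z, z ∈ I ↔ ∃ x y : ℤ, z = x * u + y * v) ∧
    O.σ₁ u * O.σ₂ u = κ * Q.a ∧ O.σ₁ u * O.σ₂ v = κ * (Q.b / 2 + √(N : ℝ)) ∧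
    O.σ₁ v * O.σ₂ u = κ * (Q.b / 2 - √(N : ℝ)) ∧ O.σ₁ v * O.σ₂ v = κ * Q.c

variable {O}

theorem Represents.of_properlyEquivalent {I : FractionalIdeal R⁰ K} {Q Q' : BinaryForm}
    (h : O.Represents I Q) (hQ : Q.ProperlyEquivalent Q') : O.Represents I Q' := by
  obtain ⟨u, v, κ, hκ, hI, h₁, h₂, h₃, h₄⟩ := h
  obtain ⟨γ, hγ⟩ := hQ
  have hd : γ 0 0 * γ 1 1 - γ 0 1 * γ 1 0 = 1 := by
    rw [← Matrix.det_fin_two]; exact γ.det_coe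
  generalize γ 0 0 = p, γ 0 1 = q, γ 1 0 = r, γ 1 1 = s at hγ hd
  have ha := hγ 1 0
  have hc := hγ 0 1
  have hb := hγ 1 1
  simp only [BinaryForm.eval] at ha hb hc
  have ha' : (Q'.a : ℝ) = Q.a * p ^ 2 + Q.b * p * r + Q.c * r ^ 2 := by
    norm_cast; linear_combination ha
  have hc' : (Q'.c : ℝ) = Q.a * q ^ 2 + Q.b * q * s + Q.c * s ^ 2 := by
    norm_cast; linear_combination hc
  have hb' : (Q'.b : ℝ) = 2 * Q.a * p * q + Q.b * (p * s + q * r) + 2 * Q.c * r * s := by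
    norm_cast; linear_combination hb - ha - hc
  have hdR : (p : ℝ) * s - q * r = 1 := by exact_mod_cast hd
  have hdK : (p : K) * s - q * r = 1 := by exact_mod_cast congrArg (Int.cast : ℤ → K) hd
  refine ⟨p * u + r * v, q * u + s * v, κ, hκ, fun z => ?_, ?_, ?_, ?_, ?_⟩
  · rw [hI]
    constructor
    · rintro ⟨x, y, rfl⟩
      refine ⟨s * x - q * y, p * y - r * x, ?_⟩
      push_cast
      linear_combination (-(x * u) - y * v) * hdK
    · rintro ⟨x, y, rfl⟩
      refine ⟨p * x + q * y, r * x + s * y, ?_⟩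
      push_cast
      ring
  all_goals simp only [map_add, map_mul, map_intCast]
  · linear_combination p ^ 2 * h₁ + p * r * h₂ + p * r * h₃ + r ^ 2 * h₄ - κ * ha'
  · linear_combination p * q * h₁ + p * s * h₂ + q * r * h₃ + r * s * h₄ - κ / 2 * hb' +
      κ * √(N : ℝ) * hdR
  · linear_combination p * q * h₁ + q * r * h₂ + p * s * h₃ + r * s * h₄ - κ / 2 * hb' -
      κ * √(N : ℝ) * hdR
  · linear_combination -κ * hc' + q ^ 2 * h₁ + q * s * h₂ + q * s * h₃ + s ^ 2 * h₄

/-- The form represented by an ideal is determined up to proper equivalence. -/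
theorem Represents.properlyEquivalent {I : FractionalIdeal R⁰ K} {Q Q' : BinaryForm}
    (h : O.Represents I Q) (h' : O.Represents I Q') : Q.ProperlyEquivalent Q' := by
  obtain ⟨u, v, κ, hκ, hI, h₁, h₂, h₃, h₄⟩ := h
  obtain ⟨u', v', κ', hκ', hI', h₁', h₂', h₃', h₄'⟩ := h'
  have hs := O.sqrt_pos
  -- The mixed products differ by `2κ√N ≠ 0`, so the basis is independent over ℤ.
  have indep : ∀ x y : ℤ, (x : K) * u + y * v = 0 → x = 0 ∧ y = 0 := by
    intro x y hxy
    have k₁ := congrArg O.σ₁ hxy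
    have k₂ := congrArg O.σ₂ hxy
    simp only [map_add, map_mul, map_intCast, map_zero] at k₁ k₂
    have hne : 2 * κ * √(N : ℝ) ≠ 0 := by positivity
    have hx : (x : ℝ) * (2 * κ * √(N : ℝ)) = 0 := by
      linear_combination O.σ₂ v * k₁ - O.σ₁ v * k₂ - x * h₂ + x * h₃
    have hy : (y : ℝ) * (2 * κ * √(N : ℝ)) = 0 := by
      linear_combination O.σ₁ u * k₂ - O.σ₂ u * k₁ - y * h₂ + y * h₃
    exact ⟨by simpa [hne] using hx, by simpa [hne] using hy⟩
  obtain ⟨p, r, hu'⟩ := (hI u').mp ((hI' u').mpr ⟨1, 0, by simp⟩)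
  obtain ⟨q, s, hv'⟩ := (hI v').mp ((hI' v').mpr ⟨0, 1, by simp⟩)
  obtain ⟨p', r', hu⟩ := (hI' u).mp ((hI u).mpr ⟨1, 0, by simp⟩)
  obtain ⟨q', s', hv⟩ := (hI' v).mp ((hI v).mpr ⟨0, 1, by simp⟩)
  obtain ⟨i₁, i₂⟩ := indep (p * p' + q * r' - 1) (r * p' + s * r') (by
    push_cast
    linear_combination -hu - p' * hu' - r' * hv')
  obtain ⟨i₃, i₄⟩ := indep (p * q' + q * s') (r * q' + s * s' - 1) (by
    push_cast
    linear_combination -hv - q' * hu' - s' * hv')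
  have hunit : (p * s - q * r) * (p' * s' - q' * r') = 1 := by
    linear_combination (r * q' + s * s') * i₁ + i₄ - (p * q' + q * s') * i₂
  -- The difference of the mixed products is alternating in the basis, so a change of basis scales
  -- it by the determinant. Positivity of both scales then forces determinant 1.
  have hdet : κ' = κ * ((p * s - q * r : ℤ) : ℝ) := by
    have e := congrArg₂ (fun a b => a - b) h₂' h₃'
    rw [hu', hv'] at e
    simp only [map_add, map_mul, map_intCast] at e
    have : κ' * (2 * √(N : ℝ)) = κ * ((p * s - q * r : ℤ) : ℝ) * (2 * √(N : ℝ)) := by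
      push_cast
      linear_combination -e + (p * s - q * r) * h₂ - (p * s - q * r) * h₃
    exact mul_right_cancel₀ (by positivity) this
  have hd : p * s - q * r = 1 := by
    have hpos : 0 < p * s - q * r := by
      have : (0 : ℝ) < ((p * s - q * r : ℤ) : ℝ) := by
        rw [hdet] at hκ'
        exact pos_of_mul_pos_right hκ' hκ.le
      exact_mod_cast this
    rcases Int.eq_one_or_neg_one_of_mul_eq_one hunit with h | h <;> omega
  rw [hd, Int.cast_one, mul_one] at hdet
  subst hdet
  have ha : (Q'.a : ℝ) = Q.a * p ^ 2 + Q.b * p * r + Q.c * r ^ 2 := by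
    apply mul_left_cancel₀ hκ'.ne'
    rw [← h₁', hu']
    simp only [map_add, map_mul, map_intCast]
    linear_combination p ^ 2 * h₁ + p * r * h₂ + p * r * h₃ + r ^ 2 * h₄
  have hc : (Q'.c : ℝ) = Q.a * q ^ 2 + Q.b * q * s + Q.c * s ^ 2 := by
    apply mul_left_cancel₀ hκ'.ne'
    rw [← h₄', hv']
    simp only [map_add, map_mul, map_intCast]
    linear_combination q ^ 2 * h₁ + q * s * h₂ + q * s * h₃ + s ^ 2 * h₄
  have hb : (Q'.b : ℝ) = 2 * Q.a * p * q + Q.b * (p * s + q * r) + 2 * Q.c * r * s := by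
    apply mul_left_cancel₀ hκ'.ne'
    have e := congrArg₂ (fun a b => a + b) h₂' h₃'
    rw [hu', hv'] at e
    simp only [map_add, map_mul, map_intCast] at e
    linear_combination -e + 2 * p * q * h₁ + (p * s + q * r) * h₂ + (p * s + q * r) * h₃ +
      2 * r * s * h₄
  norm_cast at ha hb hc
  refine ⟨⟨!![p, q; r, s], by rw [Matrix.det_fin_two_of]; exact hd⟩, fun x y => ?_⟩
  simp only [BinaryForm.eval, Matrix.of_apply, Matrix.cons_val', Matrix.cons_val_zero,
    Matrix.cons_val_one, Matrix.cons_val_fin_one]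
  rw [ha, hb, hc]
  ring

variable [IsFractionRing R K]

theorem Represents.smul {I : FractionalIdeal R⁰ K} {Q : BinaryForm}
    (h : O.Represents I Q) {l : K} (hl : 0 < O.σ₁ l * O.σ₂ l) :
    O.Represents (FractionalIdeal.spanSingleton R⁰ l * I) Q := by
  obtain ⟨u, v, κ, hκ, hI, h₁, h₂, h₃, h₄⟩ := h
  refine ⟨l * u, l * v, O.σ₁ l * O.σ₂ l * κ, mul_pos hl hκ, fun z => ?_, ?_, ?_, ?_, ?_⟩
  · rw [FractionalIdeal.mem_singleton_mul]
    constructor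
    · rintro ⟨w, hw, rfl⟩
      obtain ⟨x, y, rfl⟩ := (hI w).mp hw
      exact ⟨x, y, by ring⟩
    · rintro ⟨x, y, rfl⟩
      exact ⟨x * u + y * v, (hI _).mpr ⟨x, y, rfl⟩, by ring⟩
  all_goals simp only [map_mul]
  · linear_combination O.σ₁ l * O.σ₂ l * h₁
  · linear_combination O.σ₁ l * O.σ₂ l * h₂
  · linear_combination O.σ₁ l * O.σ₂ l * h₃
  · linear_combination O.σ₁ l * O.σ₂ l * h₄

/-- Two ideals represented by the same form differ by a factor of positive norm. -/
theorem Represents.exists_eq_smul {I I' : FractionalIdeal R⁰ K} {Q : BinaryForm}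
    (h : O.Represents I Q) (h' : O.Represents I' Q) :
    ∃ l : K, 0 < O.σ₁ l * O.σ₂ l ∧ I' = FractionalIdeal.spanSingleton R⁰ l * I := by
  obtain ⟨u, v, κ, hκ, hI, h₁, h₂, h₃, h₄⟩ := h
  obtain ⟨u', v', κ', hκ', hI', h₁', h₂', h₃', h₄'⟩ := h'
  have hs := O.sqrt_pos
  have hu : u ≠ 0 := by
    rintro rfl
    simp only [map_zero, zero_mul, mul_zero, zero_eq_mul, hκ.ne', false_or] at h₂ h₃
    linarith
  have hσ : 0 < O.σ₁ (u' / u) * O.σ₂ (u' / u) := by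
    have e₁ : O.σ₁ u ≠ 0 := by simpa using hu
    have e₂ : O.σ₂ u ≠ 0 := by simpa using hu
    have ha : (Q.a : ℝ) ≠ 0 := by
      intro ha
      rw [ha, mul_zero] at h₁
      exact mul_ne_zero e₁ e₂ h₁
    rw [map_div₀, map_div₀, div_mul_div_comm, h₁, h₁', mul_div_mul_right _ _ ha]
    positivity
  -- The form fixes the ratio `v / u`: under `σ₁` it is `(b/2 - √N) / a`.
  have hv : v' = u' / u * v := by
    apply O.σ₁.injective
    have e₁ : O.σ₁ u ≠ 0 := by simpa using hu
    have e₂ : O.σ₂ u ≠ 0 := by simpa using hu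
    have e₃ : O.σ₂ u' ≠ 0 := by
      have := right_ne_zero_of_mul hσ.ne'
      rw [map_div₀] at this
      exact fun h => this (by rw [h, zero_div])
    rw [map_mul, map_div₀]
    rw [div_mul_eq_mul_div, eq_div_iff e₁]
    apply mul_right_cancel₀ (mul_ne_zero e₂ e₃)
    calc O.σ₁ v' * O.σ₁ u * (O.σ₂ u * O.σ₂ u')
        = (O.σ₁ v' * O.σ₂ u') * (O.σ₁ u * O.σ₂ u) := by ring
      _ = (O.σ₁ u' * O.σ₂ u') * (O.σ₁ v * O.σ₂ u) := by rw [h₁, h₁', h₃, h₃']; ring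
      _ = _ := by ring
  refine ⟨u' / u, hσ, ?_⟩
  ext z
  rw [FractionalIdeal.mem_singleton_mul, hI']
  constructor
  · rintro ⟨x, y, rfl⟩
    refine ⟨x * u + y * v, (hI _).mpr ⟨x, y, rfl⟩, ?_⟩
    rw [hv, mul_add]
    field_simp
  · rintro ⟨w, hw, rfl⟩
    obtain ⟨x, y, rfl⟩ := (hI w).mp hw
    refine ⟨x, y, ?_⟩
    rw [hv, mul_add]
    field_simp

/-! ### The real embeddings and total positivity -/

variable (O)

/-- An embedding of `K` into `ℝ` is determined by the image of `ω`. -/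
theorem ringHom_ext {σ τ : K →+* ℝ} (h : σ (algebraMap R K O.ω) = τ (algebraMap R K O.ω)) :
    σ = τ := by
  have key : ∀ r : R, σ (algebraMap R K r) = τ (algebraMap R K r) := by
    intro r
    obtain ⟨x, y, rfl⟩ := O.exists_coord r
    simp [h]
  ext z
  obtain ⟨x, y, -, rfl⟩ := IsFractionRing.div_surjective R z
  rw [map_div₀, map_div₀, key, key]

theorem eq_σ₁_or_eq_σ₂ (σ : K →+* ℝ) : σ = O.σ₁ ∨ σ = O.σ₂ := by
  have h : σ (algebraMap R K O.ω) * σ (algebraMap R K O.ω) = √(N : ℝ) * √(N : ℝ) := by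
    rw [← map_mul, ← map_mul, O.ω_mul_self, O.sqrt_mul_sqrt]
    simp
  rcases mul_self_eq_mul_self_iff.mp h with h | h
  · exact Or.inl (O.ringHom_ext (h.trans O.σ₁_ω.symm))
  · exact Or.inr (O.ringHom_ext (h.trans O.σ₂_ω.symm))

theorem mem_totallyPositive_iff {x : Kˣ} :
    x ∈ totallyPositive K ↔ 0 < O.σ₁ x ∧ 0 < O.σ₂ x := by
  constructor
  · exact fun h => ⟨h O.σ₁, h O.σ₂⟩
  · rintro ⟨h₁, h₂⟩ σ
    rcases O.eq_σ₁_or_eq_σ₂ σ with rfl | rfl <;> assumption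

end RealQuadraticOrder

/-- An element that multiplies an invertible ideal into itself is integral. -/
theorem FractionalIdeal.mem_range_of_mul_mem {R K : Type*} [CommRing R] [Field K]
    [Algebra R K] [IsFractionRing R K]
    (I : (FractionalIdeal R⁰ K)ˣ) {t : K}
    (ht : ∀ z ∈ (I : FractionalIdeal R⁰ K), t * z ∈ (I : FractionalIdeal R⁰ K)) :
    ∃ r : R, algebraMap R K r = t := by
  have hle : FractionalIdeal.spanSingleton R⁰ t * (I : FractionalIdeal R⁰ K) ≤ I := by
    intro z hz
    obtain ⟨w, hw, rfl⟩ := FractionalIdeal.mem_singleton_mul.mp hz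
    exact ht w hw
  have h1 : FractionalIdeal.spanSingleton R⁰ t ≤ 1 := by
    have := mul_le_mul_left hle ((I⁻¹ : (FractionalIdeal R⁰ K)ˣ) : FractionalIdeal R⁰ K)
    rwa [mul_assoc, Units.mul_inv, mul_one] at this
  exact (FractionalIdeal.mem_one_iff _).mp (h1 (FractionalIdeal.mem_spanSingleton_self _ t))

theorem BinaryForm.isPrimitive_iff {Q : BinaryForm} :
    Q.IsPrimitive ↔ ∀ l : ℤ, l ∣ Q.a → l ∣ Q.b → l ∣ Q.c → l ∣ 1 := by
  unfold IsPrimitive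
  constructor
  · intro h l ha hb hc
    have := Int.dvd_coe_gcd (Int.dvd_coe_gcd ha hb) hc
    rwa [h] at this
  · intro h
    have := h (Int.gcd (Int.gcd Q.a Q.b) Q.c)
      ((Int.gcd_dvd_left _ _).trans (Int.gcd_dvd_left _ _))
      ((Int.gcd_dvd_left _ _).trans (Int.gcd_dvd_right _ _)) (Int.gcd_dvd_right _ _)
    exact Nat.dvd_one.mp (by exact_mod_cast this)

/-! ### From forms to invertible ideals and back -/

namespace RealQuadraticOrder

variable {N : ℤ} {R K : Type*} [CommRing R] [Field K] [Algebra R K]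
  (O : RealQuadraticOrder N R K)

/-- Every ideal of `ℤ[ω]` is generated by two elements as an abelian group. -/
theorem exists_ideal_basis (O : RealQuadraticOrder N R K) (J : Ideal R) :
    ∃ u v : R, ∀ z, z ∈ J ↔ ∃ x y : ℤ, z = x * u + y * v := by
  -- Hermite normal form: `B` is `J ∩ ℤ` and `A` the ideal of `ω`-coordinates of `J`. A generator of
  -- `B`, and an element of `J` whose `ω`-coordinate generates `A`, span `J`.
  let B : Ideal ℤ := J.comap (Int.castRingHom R)
  let A : Ideal ℤ :=
    { carrier := {y | ∃ x : ℤ, (x : R) + y * O.ω ∈ J}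
      zero_mem' := ⟨0, by simp⟩
      add_mem' := by
        rintro y y' ⟨x, hx⟩ ⟨x', hx'⟩
        refine ⟨x + x', ?_⟩
        convert J.add_mem hx hx' using 1
        push_cast
        ring
      smul_mem' := by
        rintro k y ⟨x, hx⟩
        refine ⟨k * x, ?_⟩
        convert J.mul_mem_left (k : R) hx using 1
        rw [smul_eq_mul]
        push_cast
        ring }
  obtain ⟨g, hg⟩ := (IsPrincipalIdealRing.principal A).principal
  obtain ⟨a, ha⟩ := (IsPrincipalIdealRing.principal B).principal
  obtain ⟨b, hb⟩ : g ∈ A := by rw [hg]; exact Submodule.mem_span_singleton_self g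
  have haJ : (a : R) ∈ J := by
    have : a ∈ B := by rw [ha]; exact Submodule.mem_span_singleton_self a
    exact this
  refine ⟨a, b + g * O.ω, fun z => ⟨fun hz => ?_, ?_⟩⟩
  · obtain ⟨x, y, rfl⟩ := O.exists_coord z
    have hy : y ∈ A := ⟨x, hz⟩
    rw [hg] at hy
    obtain ⟨k, rfl⟩ := Submodule.mem_span_singleton.mp hy
    have hx : x - k * b ∈ B := by
      change ((x - k * b : ℤ) : R) ∈ J
      convert J.sub_mem hz (J.mul_mem_left (k : R) hb) using 1
      rw [smul_eq_mul]
      push_cast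
      ring
    rw [ha] at hx
    obtain ⟨m, hm⟩ := Submodule.mem_span_singleton.mp hx
    refine ⟨m, k, ?_⟩
    have hm' := congrArg (Int.cast : ℤ → R) hm
    rw [smul_eq_mul] at *
    push_cast at hm' ⊢
    linear_combination -hm'
  · rintro ⟨x, y, rfl⟩
    exact J.add_mem (J.mul_mem_left _ haJ) (J.mul_mem_left _ hb)

theorem intCast_ne_zero (O : RealQuadraticOrder N R K) {l : ℤ} (hl : l ≠ 0) : (l : K) ≠ 0 := by
  rw [← map_ne_zero O.σ₁, map_intCast]
  exact_mod_cast hl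

theorem dvd_one_of_mul_eq_add_ω {l p : ℤ} {r : R}
    (h : (l : K) * algebraMap R K r = p + algebraMap R K O.ω) : l ∣ 1 := by
  obtain ⟨x, y, rfl⟩ := O.exists_coord r
  have k₁ := congrArg O.σ₁ h
  have k₂ := congrArg O.σ₂ h
  simp only [map_add, map_mul, map_intCast, O.σ₁_ω, O.σ₂_ω] at k₁ k₂
  have hs := O.sqrt_pos
  have : (l : ℝ) * y = 1 := by
    apply mul_right_cancel₀ (b := 2 * √(N : ℝ)) (by positivity)
    linear_combination k₁ - k₂
  exact ⟨y, by exact_mod_cast this.symm⟩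

variable [IsFractionRing R K]

/-- Every primitive form of discriminant `4 N` represents an invertible ideal. -/
theorem exists_represents_of_form {Q : BinaryForm} (hQ : Q.IsPrimitive) (hd : Q.disc = 4 * N) :
    ∃ I : (FractionalIdeal R⁰ K)ˣ, O.Represents (I : FractionalIdeal R⁰ K) Q := by
  have hs := O.sqrt_pos
  obtain ⟨a, b, c⟩ := Q
  simp only [BinaryForm.disc] at hd
  obtain ⟨β, rfl⟩ : 2 ∣ b := by
    apply Int.prime_two.dvd_of_dvd_pow (n := 2)
    exact ⟨2 * N + 2 * a * c, by linear_combination hd⟩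
  have hN : N = β ^ 2 - a * c := by linarith
  have ha : a ≠ 0 := by
    rintro rfl
    exact O.not_isSquare ⟨β, by rw [hN]; ring⟩
  obtain ⟨x₀, y₀, z₀, hxyz⟩ : ∃ x y z : ℤ, a * x + 2 * β * y + c * z = 1 := by
    refine ⟨Int.gcdA a (2 * β) * Int.gcdA (Int.gcd a (2 * β)) c,
      Int.gcdB a (2 * β) * Int.gcdA (Int.gcd a (2 * β)) c, Int.gcdB (Int.gcd a (2 * β)) c, ?_⟩
    have e₁ := Int.gcd_eq_gcd_ab (Int.gcd a (2 * β)) c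
    have e₂ := Int.gcd_eq_gcd_ab a (2 * β)
    have e₃ : Int.gcd (Int.gcd a (2 * β)) c = 1 := hQ
    rw [e₃] at e₁
    push_cast at e₁
    linear_combination -e₁ - Int.gcdA (Int.gcd a (2 * β)) c * e₂
  set w := algebraMap R K O.ω with hw
  have hww : w * w = N := by
    rw [hw, ← map_mul, O.ω_mul_self, map_intCast]
  have haK : (a : K) ≠ 0 := O.intCast_ne_zero ha
  have hNK : (N : K) = β ^ 2 - a * c := by rw [hN]; push_cast; ring
  let S : K → FractionalIdeal R⁰ K := FractionalIdeal.spanSingleton R⁰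
  -- The conjugate lattice divided by `a` is the inverse: the product is generated by `a`, `β + w`,
  -- `β - w` and `c`, and contains `gcd(a, 2β, c) = 1`.
  have hmul : (S a + S (β - w)) * (S 1 + S ((β + w) / a)) = 1 := by
    have e : (S a + S (β - w)) * (S 1 + S ((β + w) / a)) =
        S a + S (β + w) + (S (β - w) + S c) := by
      simp only [S, add_mul, mul_add, FractionalIdeal.spanSingleton_mul_spanSingleton, mul_one]
      rw [mul_div_cancel₀ _ haK, mul_div_assoc', show ((β : K) - w) * (β + w) / a = c by
        rw [div_eq_iff haK]; linear_combination -hww - hNK]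
      abel
    rw [e]
    have hle : ∀ r : R, S (algebraMap R K r) ≤ 1 := by
      intro r
      rw [FractionalIdeal.spanSingleton_le_iff_mem, FractionalIdeal.mem_one_iff]
      exact ⟨r, rfl⟩
    have hmem : ∀ (k : ℤ) (z : K), (k : K) * z ∈ S z := fun k z =>
      (FractionalIdeal.mem_spanSingleton _).mpr ⟨k, by rw [Algebra.smul_def, map_intCast]⟩
    apply le_antisymm
    · have h₁ := hle a
      have h₂ := hle (β + O.ω)
      have h₃ := hle (β - O.ω)
      have h₄ := hle c
      simp only [map_add, map_sub, map_intCast, ← hw] at h₁ h₂ h₃ h₄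
      simp only [← FractionalIdeal.sup_eq_add]
      exact sup_le (sup_le h₁ h₂) (sup_le h₃ h₄)
    · rw [FractionalIdeal.one_le]
      have : (1 : K) = (x₀ * a + y₀ * (β + w)) + (y₀ * (β - w) + z₀ * c) := by
        have := congrArg (Int.cast : ℤ → K) hxyz
        push_cast at this
        linear_combination -this
      rw [this]
      exact (FractionalIdeal.mem_add _ _ _).mpr ⟨_, (FractionalIdeal.mem_add _ _ _).mpr
        ⟨_, hmem _ _, _, hmem _ _, rfl⟩, _, (FractionalIdeal.mem_add _ _ _).mpr
        ⟨_, hmem _ _, _, hmem _ _, rfl⟩, rfl⟩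
  have hspan : ∀ z, z ∈ S a + S (β - w) ↔ ∃ x y : ℤ, z = x * a + y * (β - w) := by
    intro z
    simp only [S, FractionalIdeal.mem_add, FractionalIdeal.mem_spanSingleton]
    constructor
    · rintro ⟨_, ⟨r, rfl⟩, _, ⟨t, rfl⟩, rfl⟩
      obtain ⟨x, y, rfl⟩ := O.exists_coord r
      obtain ⟨x', y', rfl⟩ := O.exists_coord t
      refine ⟨x + y * β + y' * c, -(y * a) + x' - y' * β, ?_⟩
      simp only [Algebra.smul_def, map_add, map_mul, map_intCast, ← hw]
      push_cast
      linear_combination -y' * hww - y' * hNK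
    · rintro ⟨x, y, rfl⟩
      refine ⟨_, ⟨(x : R), rfl⟩, _, ⟨(y : R), rfl⟩, ?_⟩
      simp only [Algebra.smul_def, map_intCast]
  -- The basis `a`, `β - w` has scale `κ = a`. Multiplying by `l` changes it to `a` times the norm
  -- of `l`, which allows a negative `a` to be corrected by `l = ω`, of norm `-N`.
  have key : ∀ l : K, l ≠ 0 → 0 < O.σ₁ l * O.σ₂ l * a →
      ∃ I : (FractionalIdeal R⁰ K)ˣ, O.Represents (I : FractionalIdeal R⁰ K) ⟨a, 2 * β, c⟩ := by
    intro l hl hpos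
    refine ⟨toPrincipalIdeal R K (Units.mk0 l hl) * Units.mkOfMulEqOne _ _ hmul, l * a,
      l * (β - w), O.σ₁ l * O.σ₂ l * a, hpos, fun z => ?_, ?_, ?_, ?_, ?_⟩
    · rw [Units.val_mul, coe_toPrincipalIdeal, FractionalIdeal.mem_singleton_mul]
      simp only [Units.val_mkOfMulEqOne, hspan, Units.val_mk0]
      constructor
      · rintro ⟨_, ⟨x, y, rfl⟩, rfl⟩
        exact ⟨x, y, by ring⟩
      · rintro ⟨x, y, rfl⟩
        exact ⟨_, ⟨x, y, rfl⟩, by ring⟩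
    all_goals simp only [map_mul, map_sub, map_intCast, hw, O.σ₁_ω, O.σ₂_ω]; push_cast
    · ring
    · ring
    · ring
    · have hNR : (N : ℝ) = β ^ 2 - a * c := by rw [hN]; push_cast; ring
      linear_combination -(O.σ₁ l * O.σ₂ l) * (O.sqrt_mul_sqrt + hNR)
  rcases ha.lt_or_gt with ha | ha
  · refine key w O.algebraMap_ω_ne_zero ?_
    rw [hw, O.σ₁_ω, O.σ₂_ω]
    have : (a : ℝ) < 0 := by exact_mod_cast ha
    nlinarith [mul_pos hs hs]
  · exact key 1 one_ne_zero (by simpa using ha)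

variable [IsDomain R]

theorem exists_basis (O : RealQuadraticOrder N R K) (I : FractionalIdeal R⁰ K) :
    ∃ u v : K, ∀ z, z ∈ I ↔ ∃ x y : ℤ, z = x * u + y * v := by
  obtain ⟨a, J, -, rfl⟩ := FractionalIdeal.exists_eq_spanSingleton_mul I
  obtain ⟨u, v, h⟩ := O.exists_ideal_basis J
  refine ⟨(algebraMap R K a)⁻¹ * algebraMap R K u, (algebraMap R K a)⁻¹ * algebraMap R K v,
    fun z => ?_⟩
  rw [FractionalIdeal.mem_singleton_mul]
  constructor
  · rintro ⟨w, hw, rfl⟩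
    obtain ⟨w', hw', rfl⟩ := (FractionalIdeal.mem_coeIdeal _).mp hw
    obtain ⟨x, y, rfl⟩ := (h w').mp hw'
    exact ⟨x, y, by simp only [map_add, map_mul, map_intCast]; ring⟩
  · rintro ⟨x, y, rfl⟩
    refine ⟨algebraMap R K (x * u + y * v), (FractionalIdeal.mem_coeIdeal _).mpr
      ⟨_, (h _).mpr ⟨x, y, rfl⟩, rfl⟩, ?_⟩
    simp only [map_add, map_mul, map_intCast]
    ring

/-- Every invertible ideal is represented by a primitive form of discriminant `4 N`. -/
theorem exists_represents (I : (FractionalIdeal R⁰ K)ˣ) :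
    ∃ Q : BinaryForm, (Q.IsPrimitive ∧ Q.disc = 4 * N) ∧
      O.Represents (I : FractionalIdeal R⁰ K) Q := by
  have hs := O.sqrt_pos
  have hI0 : ∃ z ∈ (I : FractionalIdeal R⁰ K), z ≠ 0 := by
    by_contra! h
    exact I.ne_zero (FractionalIdeal.eq_zero_iff.mpr h)
  have hω : ∀ z ∈ (I : FractionalIdeal R⁰ K),
      algebraMap R K O.ω * z ∈ (I : FractionalIdeal R⁰ K) := by
    intro z hz
    rw [← Algebra.smul_def]
    exact Submodule.smul_mem (I : FractionalIdeal R⁰ K).coeToSubmodule _ hz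
  have aux : ∀ u v : K,
      (∀ z, z ∈ (I : FractionalIdeal R⁰ K) ↔ ∃ x y : ℤ, z = x * u + y * v) →
      ∃ (p q r : ℤ) (κ : ℝ), κ ≠ 0 ∧ O.σ₁ u * O.σ₂ u = κ * -q ∧
        O.σ₁ u * O.σ₂ v = κ * (p + √(N : ℝ)) ∧ O.σ₁ v * O.σ₂ u = κ * (p - √(N : ℝ)) ∧
        O.σ₁ v * O.σ₂ v = κ * r ∧
        p ^ 2 + q * r = N ∧ (∀ l : ℤ, l ∣ 2 * p → l ∣ q → l ∣ r → l ∣ 1) := by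
    intro u v huv
    -- The matrix of multiplication by `ω` has trace zero, so `s = -p`, and its entries give the
    -- norm form, proportional to `(-q, 2p, r)`.
    obtain ⟨p, q, hp⟩ := (huv _).mp (hω u ((huv u).mpr ⟨1, 0, by simp⟩))
    obtain ⟨r, s, hr⟩ := (huv _).mp (hω v ((huv v).mpr ⟨0, 1, by simp⟩))
    have p₁ := congrArg O.σ₁ hp
    have p₂ := congrArg O.σ₂ hp
    have r₁ := congrArg O.σ₁ hr
    have r₂ := congrArg O.σ₂ hr
    simp only [map_add, map_mul, map_intCast, O.σ₁_ω, O.σ₂_ω] at p₁ p₂ r₁ r₂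
    have hu : u ≠ 0 := by
      rintro rfl
      obtain ⟨z, hz, hz0⟩ := hI0
      obtain ⟨x, y, rfl⟩ := (huv z).mp hz
      have hv : O.σ₁ v ≠ 0 := by
        rw [map_ne_zero]
        rintro rfl
        simp at hz0
      rw [map_zero, mul_zero, zero_add] at r₁
      exact O.sqrt_ne_intCast s (mul_right_cancel₀ hv r₁)
    have hN : O.σ₁ u * O.σ₂ u ≠ 0 := by simpa using hu
    obtain ⟨κ, hκ⟩ : ∃ κ : ℝ, O.σ₁ u * O.σ₂ v - O.σ₁ v * O.σ₂ u = κ * (2 * √(N : ℝ)) :=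
      ⟨_, (div_mul_cancel₀ _ (by positivity)).symm⟩
    have hs0 : √(N : ℝ) ≠ 0 := hs.ne'
    have ha : O.σ₁ u * O.σ₂ u = κ * -q := by
      apply mul_right_cancel₀ (b := 2 * √(N : ℝ)) (by positivity)
      linear_combination O.σ₂ u * p₁ - O.σ₁ u * p₂ - q * hκ
    have hκ0 : κ ≠ 0 := by
      rintro rfl
      exact hN (by rw [ha, zero_mul])
    have hc : O.σ₁ v * O.σ₂ v = κ * r := by
      apply mul_right_cancel₀ (b := 2 * √(N : ℝ)) (by positivity)
      linear_combination O.σ₂ v * r₁ - O.σ₁ v * r₂ + r * hκ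
    have hb : O.σ₁ u * O.σ₂ v + O.σ₁ v * O.σ₂ u = 2 * κ * p := by
      apply mul_right_cancel₀ hs0
      linear_combination O.σ₂ v * p₁ - O.σ₁ v * p₂ + p * hκ
    have hb' : O.σ₁ u * O.σ₂ v + O.σ₁ v * O.σ₂ u = -(2 * κ * s) := by
      apply mul_right_cancel₀ hs0
      linear_combination O.σ₂ u * r₁ - O.σ₁ u * r₂ - s * hκ
    have hsp : s = -p := by
      have : (s : ℝ) = -p := by
        apply mul_left_cancel₀ (mul_ne_zero two_ne_zero hκ0)
        linear_combination hb' - hb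
      exact_mod_cast this
    have hq : q ≠ 0 := by
      rintro rfl
      exact hN (by rw [ha]; simp)
    have h₂ : O.σ₁ u * O.σ₂ v = κ * (p + √(N : ℝ)) := by linear_combination (hκ + hb) / 2
    have h₃ : O.σ₁ v * O.σ₂ u = κ * (p - √(N : ℝ)) := by linear_combination (hb - hκ) / 2
    refine ⟨p, q, r, κ, hκ0, ha, h₂, h₃, hc, ?_, ?_⟩
    · have : (p : ℝ) ^ 2 + q * r = N := by
        apply mul_left_cancel₀ (mul_ne_zero hκ0 hκ0)
        have e₁ := congrArg₂ (· * ·) ha hc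
        have e₂ := congrArg₂ (· * ·) h₂ h₃
        linear_combination e₁ - e₂ + κ * κ * O.sqrt_mul_sqrt
      exact_mod_cast this
    · rintro l ⟨p', hp'⟩ ⟨q', rfl⟩ ⟨r', rfl⟩
      have hl : (l : K) ≠ 0 := O.intCast_ne_zero (left_ne_zero_of_mul hq)
      -- `p + ω` sends `u` to `2pu + qv` and `v` to `ru`. A common divisor `l` of `2p, q, r` thus
      -- makes `(p + ω) / l` a multiplier of `I`, hence an element of `R`.
      obtain ⟨t, ht⟩ := FractionalIdeal.mem_range_of_mul_mem I
        (t := (p + algebraMap R K O.ω) / l) (by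
          intro z hz
          obtain ⟨x, y, rfl⟩ := (huv z).mp hz
          refine (huv _).mpr ⟨x * p' + y * r', x * q', ?_⟩
          rw [div_mul_eq_mul_div, div_eq_iff hl]
          have hpK := congrArg (Int.cast : ℤ → K) hp'
          rw [hsp] at hr
          push_cast at hp hr hpK ⊢
          linear_combination x * hp + y * hr + x * u * hpK)
      exact O.dvd_one_of_mul_eq_add_ω (K := K) (l := l) (p := p) (r := t)
        (by rw [ht, mul_div_cancel₀ _ hl])
  obtain ⟨u, v, huv⟩ := O.exists_basis (I : FractionalIdeal R⁰ K)
  obtain ⟨p, q, r, κ, hκ, h₁, h₂, h₃, h₄, hN, hl⟩ := aux u v huv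
  rcases hκ.lt_or_gt with hκ | hκ
  -- A negatively oriented basis is corrected by exchanging its two vectors.
  · refine ⟨⟨-r, -2 * p, q⟩, ⟨BinaryForm.isPrimitive_iff.mpr fun l ha hb hc =>
      hl l (by simpa using hb) hc (by simpa using ha), ?_⟩,
      v, u, -κ, by linarith, fun z => ?_, ?_, ?_, ?_, ?_⟩
    · simp only [BinaryForm.disc]
      linear_combination 4 * hN
    · rw [huv]
      constructor <;> rintro ⟨x, y, rfl⟩ <;> exact ⟨y, x, by ring⟩
    all_goals push_cast
    · linear_combination h₄
    · linear_combination h₃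
    · linear_combination h₂
    · linear_combination h₁
  · refine ⟨⟨-q, 2 * p, r⟩, ⟨BinaryForm.isPrimitive_iff.mpr fun l ha hb hc =>
      hl l hb (by simpa using ha) hc, ?_⟩, u, v, κ, hκ, huv, ?_, ?_, ?_, ?_⟩
    · simp only [BinaryForm.disc]
      linear_combination 4 * hN
    all_goals push_cast
    · exact h₁
    · linear_combination h₂
    · linear_combination h₃
    · exact h₄

end RealQuadraticOrder

/-! ### Ideal classes and form classes -/

/-- A correspondence that respects two equivalence relations identifies their quotients. -/
theorem Nat.card_quotient_eq_of_relation {α β : Type*} (s : Setoid α) (t : Setoid β)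
    (r : α → β → Prop) (hα : ∀ a, ∃ b, r a b) (hβ : ∀ b, ∃ a, r a b)
    (h : ∀ a a' b b', r a b → r a' b' → (s a a' ↔ t b b')) :
    Nat.card (Quotient s) = Nat.card (Quotient t) := by
  choose F hF using hα
  refine Nat.card_congr (Equiv.ofBijective
    (Quotient.map F fun a a' haa' => (h a a' _ _ (hF a) (hF a')).mp haa') ⟨?_, ?_⟩)
  · rintro ⟨a⟩ ⟨a'⟩ haa'
    exact Quotient.sound ((h a a' _ _ (hF a) (hF a')).mpr (Quotient.exact haa'))
  · rintro ⟨b⟩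
    obtain ⟨a, ha⟩ := hβ b
    exact ⟨Quotient.mk s a, Quotient.sound ((h a a _ _ (hF a) ha).mp (s.refl a))⟩

theorem FractionalIdeal.spanSingleton_neg (R : Type*) {K : Type*} [CommRing R] [Field K]
    [Algebra R K] [IsFractionRing R K] (l : K) :
    spanSingleton R⁰ (-l) = spanSingleton R⁰ l := by
  have h : ∀ k : K, spanSingleton R⁰ (-k) ≤ spanSingleton R⁰ k := fun k => by
    rw [spanSingleton_le_iff_mem, mem_spanSingleton]
    exact ⟨-1, by simp⟩
  exact le_antisymm (h l) (by simpa using h (-l))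

namespace RealQuadraticOrder

variable {N : ℤ} {R : Type*} [CommRing R]

/-- A number of positive norm generates the same ideal as a totally positive one. -/
theorem exists_totallyPositive {K : Type*} [Field K] [Algebra R K] [IsFractionRing R K]
    (O : RealQuadraticOrder N R K) {l : K} (hl : 0 < O.σ₁ l * O.σ₂ l) :
    ∃ m ∈ totallyPositive K, (m : K) = l ∨ (m : K) = -l := by
  have hl0 : l ≠ 0 := by
    rintro rfl
    simp at hl
  rcases pos_and_pos_or_neg_and_neg_of_mul_pos hl with ⟨h₁, h₂⟩ | ⟨h₁, h₂⟩
  · exact ⟨Units.mk0 l hl0, O.mem_totallyPositive_iff.mpr ⟨h₁, h₂⟩, Or.inl rfl⟩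
  · refine ⟨Units.mk0 (-l) (neg_ne_zero.mpr hl0), O.mem_totallyPositive_iff.mpr ?_, Or.inr rfl⟩
    simpa using ⟨h₁, h₂⟩

/-- The strict ideal class number of `ℤ[√N]` is the form class number of discriminant `4 N`. -/
theorem card_strictClassGroup [IsDomain R] (O : RealQuadraticOrder N R (FractionRing R)) :
    Nat.card (StrictClassGroup R) = formClassNumber (4 * N) := by
  refine Nat.card_quotient_eq_of_relation _ _
    (fun I Q => O.Represents (I : FractionalIdeal R⁰ (FractionRing R)) Q.1) (fun I => ?_)
    (fun Q => O.exists_represents_of_form Q.2.1 Q.2.2) fun I I' Q Q' h h' => ?_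
  · obtain ⟨Q, hQ, h⟩ := O.exists_represents I
    exact ⟨⟨Q, hQ⟩, h⟩
  · rw [QuotientGroup.leftRel_apply]
    constructor
    · rintro ⟨l, hl, hlI⟩
      have hpos := O.mem_totallyPositive_iff.mp hl
      have h'' := h.smul (mul_pos hpos.1 hpos.2)
      have e : I' = toPrincipalIdeal R (FractionRing R) l * I := by
        rw [hlI, mul_comm, mul_inv_cancel_left]
      rw [← coe_toPrincipalIdeal, ← Units.val_mul, ← e] at h''
      exact h''.properlyEquivalent h'
    · intro hQ
      obtain ⟨l, hl, hI⟩ := (h.of_properlyEquivalent hQ).exists_eq_smul h'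
      obtain ⟨m, hm, hml⟩ := O.exists_totallyPositive hl
      refine ⟨m, hm, ?_⟩
      rw [eq_inv_mul_iff_mul_eq]
      ext1
      rw [Units.val_mul, coe_toPrincipalIdeal, hI, mul_comm]
      rcases hml with h | h <;> rw [h]
      rw [FractionalIdeal.spanSingleton_neg R l]

/-- The kernel consists of the units of `R`, all of norm 1 by `hneg`, so the join is the group of
elements of positive norm. Multiplication by `ω`, of norm `-N < 0`, exchanges its two cosets. -/
theorem index_totallyPositive_sup_ker {K : Type*} [Field K] [Algebra R K] [IsFractionRing R K]
    (O : RealQuadraticOrder N R K) (hneg : ∀ x y : ℤ, x ^ 2 - N * y ^ 2 ≠ -1) :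
    (totallyPositive K ⊔ (toPrincipalIdeal R K).ker).index = 2 := by
  set φ := toPrincipalIdeal R K
  have hsup : ∀ l : Kˣ, l ∈ totallyPositive K ⊔ φ.ker ↔ 0 < O.σ₁ l * O.σ₂ l := by
    have hker : ∀ k ∈ φ.ker, ∃ x y : ℤ, O.σ₁ k * O.σ₂ k = ((x ^ 2 - N * y ^ 2 : ℤ) : ℝ) := by
      intro k hk
      have h := toPrincipalIdeal_eq_iff.mp (MonoidHom.mem_ker.mp hk)
      have hk1 : (k : K) ∈ (1 : FractionalIdeal R⁰ K) := by
        rw [← Units.val_one, ← h]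
        exact FractionalIdeal.mem_spanSingleton_self _ _
      obtain ⟨r, hr⟩ := (FractionalIdeal.mem_one_iff _).mp hk1
      obtain ⟨x, y, rfl⟩ := O.exists_coord r
      refine ⟨x, y, ?_⟩
      rw [← hr]
      simp only [map_add, map_mul, map_intCast, O.σ₁_ω, O.σ₂_ω]
      push_cast
      linear_combination -(y : ℝ) ^ 2 * O.sqrt_mul_sqrt
    intro l
    rw [Subgroup.mem_sup]
    constructor
    · rintro ⟨t, ht, k, hk, rfl⟩
      obtain ⟨h₁, h₂⟩ := O.mem_totallyPositive_iff.mp ht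
      obtain ⟨x, y, hxy⟩ := hker k hk
      obtain ⟨x', y', hxy'⟩ := hker k⁻¹ (φ.ker.inv_mem hk)
      have hone : (x ^ 2 - N * y ^ 2) * (x' ^ 2 - N * y' ^ 2) = 1 := by
        have : (((x ^ 2 - N * y ^ 2) * (x' ^ 2 - N * y' ^ 2) : ℤ) : ℝ) = 1 := by
          rw [Int.cast_mul, ← hxy, ← hxy', mul_mul_mul_comm, ← map_mul, ← map_mul, Units.mul_inv,
            map_one, map_one, mul_one]
        exact_mod_cast this
      rw [(Int.eq_one_or_neg_one_of_mul_eq_one hone).resolve_right (hneg x y)] at hxy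
      rw [Units.val_mul, map_mul, map_mul, mul_mul_mul_comm, hxy, Int.cast_one, mul_one]
      exact mul_pos h₁ h₂
    · intro hl
      obtain ⟨m, hm, h | h⟩ := O.exists_totallyPositive hl
      · exact ⟨m, hm, 1, φ.ker.one_mem, by ext; simp [h]⟩
      · refine ⟨m, hm, -1, ?_, by ext; simp [h]⟩
        rw [MonoidHom.mem_ker]
        ext1
        rw [coe_toPrincipalIdeal, Units.val_neg, FractionalIdeal.spanSingleton_neg]
        simp
  rw [Subgroup.index_eq_two_iff]
  refine ⟨Units.mk0 _ O.algebraMap_ω_ne_zero, fun b => ?_⟩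
  rw [hsup, hsup, Units.val_mul, Units.val_mk0, map_mul, map_mul, O.σ₁_ω, O.σ₂_ω]
  have hs := O.sqrt_pos
  have hb : O.σ₁ b * O.σ₂ b ≠ 0 := by simp
  have e : O.σ₁ b * √(N : ℝ) * (O.σ₂ b * -√(N : ℝ)) =
      -(O.σ₁ b * O.σ₂ b) * (√(N : ℝ) * √(N : ℝ)) := by ring
  rw [e, mul_pos_iff_of_pos_right (mul_pos hs hs), neg_pos]
  rcases hb.lt_or_gt with hb | hb
  · exact Or.inl ⟨hb, hb.not_gt⟩
  · exact Or.inr ⟨hb, hb.not_gt⟩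

/-- If no unit has norm `-1`, the strict ideal class number is twice the ideal class number. -/
theorem card_strictClassGroup_eq_two_mul [IsDomain R] (O : RealQuadraticOrder N R (FractionRing R))
    (hneg : ∀ x y : ℤ, x ^ 2 - N * y ^ 2 ≠ -1) :
    Nat.card (StrictClassGroup R) = 2 * Nat.card (ClassGroup R) := by
  have hrel : ((totallyPositive (FractionRing R)).map
      (toPrincipalIdeal R (FractionRing R))).relIndex
        (toPrincipalIdeal R (FractionRing R)).range = 2 := by
    rw [MonoidHom.range_eq_map, Subgroup.relIndex_map_map, top_sup_eq, Subgroup.relIndex_top_right,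
      O.index_totallyPositive_sup_ker hneg]
  have := Subgroup.relIndex_mul_index (Subgroup.map_le_range
    (toPrincipalIdeal R (FractionRing R)) (totallyPositive (FractionRing R)))
  rw [hrel] at this
  -- Both indices are the class numbers by definition.
  exact this.symm

end RealQuadraticOrder

/-! ### The orders of discriminant `184 f²` -/

theorem not_isSquare_fortySix_mul_sq {f : ℤ} (hf : f ≠ 0) : ¬ IsSquare (46 * f ^ 2) := by
  rintro ⟨r, hr⟩
  obtain ⟨s, rfl⟩ : f ∣ r := (Int.pow_dvd_pow_iff two_ne_zero).mp ⟨46, by rw [sq r, ← hr]; ring⟩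
  have h : s * s = 46 := by
    apply mul_left_cancel₀ (pow_ne_zero 2 hf)
    linear_combination -hr
  have h₁ : s ≤ 6 := by nlinarith
  have h₂ : -6 ≤ s := by nlinarith
  interval_cases s <;> omega

/-- -1 is not a square modulo 23, which divides 46. -/
theorem sq_sub_mul_sq_ne_neg_one (f x y : ℤ) : x ^ 2 - 46 * f ^ 2 * y ^ 2 ≠ -1 := by
  intro h
  have h' := congrArg (Int.cast : ℤ → ZMod 23) h
  push_cast at h'
  rw [show (46 : ZMod 23) = 0 by decide, zero_mul, zero_mul, sub_zero] at h'
  revert h'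
  generalize (x : ZMod 23) = t
  revert t
  decide

/-- `σ₁` extends the inclusion in ℝ. The conjugation `σ₂` is obtained through the identification of
`S` with `ℤ√N`. -/
theorem RealQuadraticOrder.nonempty_of_subalgebra {N : ℤ} (hN : 0 < N) (hsq : ¬ IsSquare N)
    (S : Subalgebra ℤ ℝ) (hS : √(N : ℝ) ∈ S)
    (hcoord : ∀ r ∈ S, ∃ x y : ℤ, r = x + y * √(N : ℝ)) :
    Nonempty (RealQuadraticOrder N S (FractionRing S)) := by
  have hmul : √(N : ℝ) * √(N : ℝ) = N := Real.mul_self_sqrt (by exact_mod_cast hN.le)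
  have hsq' : ∀ n : ℤ, N ≠ n * n := fun n hn => hsq ⟨n, hn⟩
  have hω : (⟨√(N : ℝ), hS⟩ : S) * ⟨√(N : ℝ), hS⟩ = (N : S) := Subtype.ext (by simpa using hmul)
  have hcoordS : ∀ r : S, ∃ x y : ℤ, r = x + y * ⟨√(N : ℝ), hS⟩ := by
    intro r
    obtain ⟨x, y, h⟩ := hcoord r r.2
    exact ⟨x, y, Subtype.ext (by simpa using h)⟩
  have hbij : Function.Bijective (Zsqrtd.lift ⟨_, hω⟩) := by
    refine ⟨Zsqrtd.lift_injective _ hsq', fun r => ?_⟩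
    obtain ⟨x, y, rfl⟩ := hcoordS r
    exact ⟨⟨x, y⟩, by simp⟩
  let e : ℤ√N ≃+* S := RingEquiv.ofBijective _ hbij
  have he : e.symm ⟨√(N : ℝ), hS⟩ = Zsqrtd.sqrtd := by
    rw [RingEquiv.symm_apply_eq]
    simp [e, Zsqrtd.sqrtd]
  let c : ℤ√N →+* ℝ := Zsqrtd.lift ⟨-√(N : ℝ), by rw [neg_mul_neg, hmul]⟩
  have hc : Function.Injective (c.comp e.symm.toRingHom) :=
    (Zsqrtd.lift_injective _ hsq').comp e.symm.injective
  have hι : Function.Injective (S.val : S →+* ℝ) := Subtype.val_injective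
  exact ⟨{
    ω := ⟨√(N : ℝ), hS⟩
    σ₁ := IsFractionRing.lift hι
    σ₂ := IsFractionRing.lift hc
    ω_mul_self := hω
    exists_coord := hcoordS
    σ₁_ω := by
      rw [IsFractionRing.lift_algebraMap]
      rfl
    σ₂_ω := by
      rw [IsFractionRing.lift_algebraMap]
      change c (e.symm _) = _
      rw [he]
      simp [c, Zsqrtd.sqrtd]
    pos := hN
    not_isSquare := hsq }⟩

/-- The order of conductor `f` of `ℚ(√184)` is `ℤ[√(46 f²)]`. -/
theorem nonempty_realQuadraticOrder_quadOrder {f : ℕ} (hf : f ≠ 0) :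
    Nonempty (RealQuadraticOrder (46 * (f : ℤ) ^ 2) (quadOrder 184 f)
      (FractionRing (quadOrder 184 f))) := by
  have hf' : (f : ℤ) ≠ 0 := by exact_mod_cast hf
  have hw : (f : ℝ) * ((((184 : ℕ) : ℝ) + √((184 : ℕ) : ℝ)) / 2) =
      92 * f + √((46 * (f : ℤ) ^ 2 : ℤ) : ℝ) := by
    have h1 : √((184 : ℕ) : ℝ) = 2 * √46 := by
      rw [show ((184 : ℕ) : ℝ) = 2 ^ 2 * 46 by norm_num, Real.sqrt_mul (by positivity),
        Real.sqrt_sq (by positivity)]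
    have h2 : √((46 * (f : ℤ) ^ 2 : ℤ) : ℝ) = √46 * f := by
      push_cast
      rw [Real.sqrt_mul (by positivity), Real.sqrt_sq (by positivity)]
    rw [h1, h2]
    push_cast
    ring
  have hmul : √((46 * (f : ℤ) ^ 2 : ℤ) : ℝ) * √((46 * (f : ℤ) ^ 2 : ℤ) : ℝ) = 46 * f ^ 2 := by
    rw [Real.mul_self_sqrt (by positivity)]
    push_cast
    ring
  refine RealQuadraticOrder.nonempty_of_subalgebra (by positivity)
    (not_isSquare_fortySix_mul_sq hf') _ ?_ ?_
  · have e : √((46 * (f : ℤ) ^ 2 : ℤ) : ℝ) =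
        (f : ℝ) * ((((184 : ℕ) : ℝ) + √((184 : ℕ) : ℝ)) / 2) - ((92 * f : ℕ) : ℝ) := by
      rw [hw]
      push_cast
      ring
    rw [e]
    exact sub_mem (Algebra.self_mem_adjoin_singleton ℤ _) (natCast_mem _ _)
  · intro r hr
    induction hr using Algebra.adjoin_induction with
    | mem x hx =>
      rw [Set.mem_singleton_iff.mp hx, hw]
      exact ⟨92 * f, 1, by push_cast; ring⟩
    | algebraMap n => exact ⟨n, 0, by simp⟩
    | add x y _ _ hx hy =>
      obtain ⟨a, b, rfl⟩ := hx
      obtain ⟨c, d, rfl⟩ := hy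
      exact ⟨a + c, b + d, by push_cast; ring⟩
    | mul x y _ _ hx hy =>
      obtain ⟨a, b, rfl⟩ := hx
      obtain ⟨c, d, rfl⟩ := hy
      refine ⟨a * c + b * d * (46 * f ^ 2), a * d + b * c, ?_⟩
      rw [Int.cast_add (a * c), Int.cast_add (a * d)]
      simp only [Int.cast_mul, Int.cast_pow, Int.cast_natCast, Int.cast_ofNat] at hmul ⊢
      linear_combination b * d * hmul

theorem strictIdealClassNumber_184_eq_formClassNumber {f : ℕ} (hf : f ≠ 0) :
    strictIdealClassNumber 184 f = formClassNumber (184 * (f : ℤ) ^ 2) := by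
  obtain ⟨O⟩ := nonempty_realQuadraticOrder_quadOrder hf
  rw [show (184 : ℤ) * (f : ℤ) ^ 2 = 4 * (46 * (f : ℤ) ^ 2) by ring]
  exact O.card_strictClassGroup

theorem strictIdealClassNumber_184_eq_two_mul {f : ℕ} (hf : f ≠ 0) :
    strictIdealClassNumber 184 f = 2 * idealClassNumber 184 f := by
  obtain ⟨O⟩ := nonempty_realQuadraticOrder_quadOrder hf
  exact O.card_strictClassGroup_eq_two_mul (sq_sub_mul_sq_ne_neg_one f)

/-! ### Reduction of indefinite forms -/

namespace BinaryForm

theorem properlyEquivalent_of_det {Q : BinaryForm} (p q r s : ℤ) (h : p * s - q * r = 1) :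
    Q.ProperlyEquivalent ⟨Q.eval p r,
      2 * Q.a * p * q + Q.b * (p * s + q * r) + 2 * Q.c * r * s, Q.eval q s⟩ := by
  refine ⟨⟨!![p, q; r, s], by rw [Matrix.det_fin_two_of]; exact h⟩, fun x y => ?_⟩
  simp only [eval, Matrix.of_apply, Matrix.cons_val', Matrix.cons_val_zero, Matrix.cons_val_one,
    Matrix.cons_val_fin_one]
  ring

theorem ProperlyEquivalent.disc_eq {Q Q' : BinaryForm} (h : Q.ProperlyEquivalent Q') :
    Q'.disc = Q.disc := by
  obtain ⟨γ, hγ⟩ := h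
  have hd : γ 0 0 * γ 1 1 - γ 0 1 * γ 1 0 = 1 := by
    rw [← Matrix.det_fin_two]; exact γ.det_coe
  generalize γ 0 0 = p, γ 0 1 = q, γ 1 0 = r, γ 1 1 = s at hγ hd
  have ha := hγ 1 0
  have hc := hγ 0 1
  have hb := hγ 1 1
  simp only [eval] at ha hb hc
  have ha' : Q'.a = Q.a * p ^ 2 + Q.b * p * r + Q.c * r ^ 2 := by linear_combination ha
  have hc' : Q'.c = Q.a * q ^ 2 + Q.b * q * s + Q.c * s ^ 2 := by linear_combination hc
  have hb' : Q'.b = 2 * Q.a * p * q + Q.b * (p * s + q * r) + 2 * Q.c * r * s := by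
    linear_combination hb - ha - hc
  simp only [disc, ha', hb', hc']
  linear_combination (Q.b ^ 2 - 4 * Q.a * Q.c) * (p * s - q * r + 1) * hd

theorem ProperlyEquivalent.exists_eval_eq {Q Q' : BinaryForm} (h : Q.ProperlyEquivalent Q')
    (x y : ℤ) : ∃ u v, Q.eval u v = Q'.eval x y :=
  let ⟨_, hγ⟩ := h
  ⟨_, _, (hγ x y).symm⟩

theorem a_ne_zero {Q : BinaryForm} (h : ¬ IsSquare Q.disc) : Q.a ≠ 0 := fun ha =>
  h ⟨Q.b, by rw [disc, ha]; ring⟩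

/-- Every form of nonsquare discriminant is properly equivalent to one with `|b| ≤ |a| ≤ |c|`. -/
theorem exists_reduced (Q : BinaryForm) (hQ : ¬ IsSquare Q.disc) :
    ∃ Q', Q.ProperlyEquivalent Q' ∧ |Q'.b| ≤ |Q'.a| ∧ |Q'.a| ≤ |Q'.c| := by
  induction hn : Q.a.natAbs using Nat.strong_induction_on generalizing Q with
  | _ n ih =>
    have ha := a_ne_zero hQ
    obtain ⟨k, hk⟩ : ∃ k : ℤ, |Q.b + 2 * Q.a * k| ≤ |Q.a| := by
      have hpos : 0 < 2 * |Q.a| := by positivity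
      have h₁ := Int.emod_nonneg (Q.b + |Q.a|) hpos.ne'
      have h₂ := Int.emod_lt_of_pos (Q.b + |Q.a|) hpos
      have h₃ := Int.emod_add_mul_ediv (Q.b + |Q.a|) (2 * |Q.a|)
      generalize (Q.b + |Q.a|) / (2 * |Q.a|) = m at h₃
      rcases abs_choice Q.a with h | h
      · have hm : |Q.a| * m = Q.a * m := by rw [h]
        exact ⟨-m, abs_le.mpr ⟨by linarith, by linarith⟩⟩
      · have hm : |Q.a| * m = -Q.a * m := by rw [h]
        exact ⟨m, abs_le.mpr ⟨by linarith, by linarith⟩⟩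
    have e := properlyEquivalent_of_det (Q := Q) 1 k 0 1 (by ring)
    set Q₁ : BinaryForm := ⟨_, _, _⟩ with hQ₁
    have ha₁ : Q₁.a = Q.a := by simp [hQ₁, eval]
    have hb₁ : Q₁.b = Q.b + 2 * Q.a * k := by simp [hQ₁]; ring
    by_cases hac : |Q₁.a| ≤ |Q₁.c|
    · exact ⟨Q₁, e, by rwa [ha₁, hb₁], hac⟩
    -- Here `|c| < |a|`, so exchanging the outer coefficients lowers `|a|`.
    · have e₂ := properlyEquivalent_of_det (Q := Q₁) 0 (-1) 1 0 (by ring)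
      set Q₂ : BinaryForm := ⟨_, _, _⟩ with hQ₂
      have ha₂ : Q₂.a = Q₁.c := by simp [hQ₂, eval]
      have e₃ := properlyEquivalent_equivalence.trans e e₂
      obtain ⟨Q', h, h'⟩ := ih Q₂.a.natAbs (by
        rw [ha₁, not_le] at hac
        rw [ha₂, ← hn]
        zify
        exact hac) Q₂ (by rwa [e₃.disc_eq]) rfl
      exact ⟨Q', properlyEquivalent_equivalence.trans e₃ h, h'⟩

/-- Since `b² ≤ |ac|`, a positive discriminant excludes `ac ≥ 0`; hence `-4ac = 4|ac|`. -/
theorem bounds_of_reduced {Q : BinaryForm} (hD : 0 < Q.disc) (h₁ : |Q.b| ≤ |Q.a|)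
    (h₂ : |Q.a| ≤ |Q.c|) :
    4 * (|Q.a| * |Q.c|) + Q.b ^ 2 = Q.disc ∧ Q.b ^ 2 ≤ |Q.a| * |Q.c| := by
  have hb : Q.b ^ 2 ≤ |Q.a| * |Q.c| := by
    rw [← sq_abs, sq]
    exact mul_le_mul h₁ (h₁.trans h₂) (abs_nonneg _) (abs_nonneg _)
  refine ⟨?_, hb⟩
  unfold disc at *
  rw [← abs_mul] at *
  rcases abs_choice (Q.a * Q.c) with h | h
  · have := abs_nonneg (Q.a * Q.c)
    nlinarith
  · rw [h]
    ring

/-- `Nat.card` of an infinite type is 0, so lower bounds on class numbers require finiteness. -/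
theorem finite_formClasses {d : ℤ} (hd : 0 < d) (hsq : ¬ IsSquare d) :
    Finite (Quotient (formSetoid d)) := by
  have key : ∀ c : Quotient (formSetoid d), ∃ t : Set.Icc (-d) d × Set.Icc (-d) d × Set.Icc (-d) d,
      c.out.1.ProperlyEquivalent ⟨t.1, t.2.1, t.2.2⟩ := by
    intro c
    have hdisc := c.out.2.2
    obtain ⟨Q', h, h₁, h₂⟩ := exists_reduced c.out.1 (by rwa [hdisc])
    have hd' : Q'.disc = d := h.disc_eq.trans hdisc
    obtain ⟨h₃, h₄⟩ := bounds_of_reduced (by rwa [hd']) h₁ h₂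
    have ha : 1 ≤ |Q'.a| := Int.one_le_abs (a_ne_zero (by rwa [hd']))
    rw [hd'] at h₃
    have hc : |Q'.c| ≤ d := by nlinarith [abs_nonneg Q'.c, sq_nonneg Q'.b]
    exact ⟨⟨⟨Q'.a, abs_le.mp (h₂.trans hc)⟩, ⟨Q'.b, abs_le.mp (h₁.trans (h₂.trans hc))⟩,
      ⟨Q'.c, abs_le.mp hc⟩⟩, h⟩
  choose F hF using key
  refine Finite.of_injective F fun c c' h => ?_
  rw [← Quotient.out_eq c, ← Quotient.out_eq c']
  have h' := hF c'
  rw [← h] at h'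
  exact Quotient.sound (properlyEquivalent_equivalence.trans (hF c)
    (properlyEquivalent_equivalence.symm h'))

/-! ### The form classes of discriminant 184 -/

/-- A form of discriminant `184` with the value `e = ±1` is properly equivalent to
`e (x² - 46 y²)`. -/
theorem properlyEquivalent_of_eval_eq {Q : BinaryForm} (hQ : Q.disc = 184) {e x y : ℤ}
    (he : e * e = 1) (h : Q.eval x y = e) : Q.ProperlyEquivalent ⟨e, 0, -46 * e⟩ := by
  obtain ⟨β, hβ⟩ : 2 ∣ Q.b := by
    apply Int.prime_two.dvd_of_dvd_pow (n := 2)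
    rw [disc] at hQ
    exact ⟨92 + 2 * Q.a * Q.c, by linear_combination hQ⟩
  -- `Q(x, y) = x(ax + by) + y(cy)` is ±1, which is already a Bézout relation for `(x, y)`.
  obtain ⟨s, q, hsq⟩ : ∃ s q : ℤ, x * s - q * y = 1 := by
    refine ⟨e * (Q.a * x + Q.b * y), -(e * (Q.c * y)), ?_⟩
    rw [eval] at h
    linear_combination e * h + he
  -- The middle coefficient is even and changes by `2ke`, so it can be made zero. The discriminant
  -- then fixes the last coefficient.
  obtain ⟨k, hk⟩ : ∃ k, 2 * Q.a * x * (q + k * x) + Q.b * (x * (s + k * y) + (q + k * x) * y) +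
      2 * Q.c * y * (s + k * y) = 0 := by
    refine ⟨-e * (Q.a * x * q + β * (x * s + q * y) + Q.c * y * s), ?_⟩
    rw [eval] at h
    linear_combination (-2 * e * (Q.a * x * q + β * (x * s + q * y) + Q.c * y * s)) * h -
      2 * (Q.a * x * q + β * (x * s + q * y) + Q.c * y * s) * he + (x * s + q * y) * hβ
  have heq := properlyEquivalent_of_det (Q := Q) x (q + k * x) y (s + k * y)
    (by linear_combination hsq)
  have hdisc := heq.disc_eq
  rw [hk, h] at heq hdisc
  rw [hQ, disc] at hdisc
  convert heq using 2
  generalize Q.eval (q + k * x) (s + k * y) = E at hdisc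
  have hE : e * E = -46 := by linarith
  linear_combination -e * hE + E * he

theorem exists_eval_eq_of_reduced {Q : BinaryForm} (hQ : Q.disc = 184) (h₁ : |Q.b| ≤ |Q.a|)
    (h₂ : |Q.a| ≤ |Q.c|) : ∃ x y, Q.eval x y = 1 ∨ Q.eval x y = -1 := by
  obtain ⟨h₃, h₄⟩ := bounds_of_reduced (by rw [hQ]; norm_num) h₁ h₂
  have ha : |Q.a| ≤ 6 := by nlinarith [abs_nonneg Q.a, sq_nonneg Q.b]
  have hb := h₁.trans ha
  obtain ⟨a, b, c⟩ := Q
  have ha0 : a ≠ 0 := by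
    rintro rfl
    simp only [abs_zero, abs_nonpos_iff] at h₁
    simp [disc, h₁] at hQ
  have hc : c = (b ^ 2 - 184) / (4 * a) := by
    symm
    apply Int.ediv_eq_of_eq_mul_right (by positivity)
    rw [disc] at hQ
    linear_combination hQ
  simp only [eval] at *
  -- A finite check: the discriminant determines `c` from `a` and `b`, the last hypothesis discards
  -- inexact quotients, and eight arguments suffice to reach ±1.
  have key : ∀ a ∈ Finset.Icc (-6 : ℤ) 6, ∀ b ∈ Finset.Icc (-6 : ℤ) 6, |b| ≤ |a| →
      |a| ≤ |(b ^ 2 - 184) / (4 * a)| → b ^ 2 - 4 * a * ((b ^ 2 - 184) / (4 * a)) = 184 →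
      ∃ q ∈ [((1 : ℤ), (0 : ℤ)), (2, 1), (2, -1), (4, 5), (4, -5), (14, 9), (14, -9), (78, 23)],
        a * q.1 ^ 2 + b * q.1 * q.2 + (b ^ 2 - 184) / (4 * a) * q.2 ^ 2 = 1 ∨
        a * q.1 ^ 2 + b * q.1 * q.2 + (b ^ 2 - 184) / (4 * a) * q.2 ^ 2 = -1 := by
    decide +kernel
  obtain ⟨q, -, hq⟩ := key a (Finset.mem_Icc.mpr (abs_le.mp ha)) b
    (Finset.mem_Icc.mpr (abs_le.mp hb)) h₁ (by rwa [← hc]) (by rw [← hc]; exact hQ)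
  rw [← hc] at hq
  exact ⟨q.1, q.2, hq⟩

theorem formClassNumber_184_le_two : formClassNumber 184 ≤ 2 := by
  have key : ∀ c : Quotient (formSetoid 184), ∃ b : Bool,
      c.out.1.ProperlyEquivalent ⟨bif b then 1 else -1, 0, -46 * bif b then 1 else -1⟩ := by
    intro c
    have hdisc := c.out.2.2
    obtain ⟨Q', h, h₁, h₂⟩ := exists_reduced c.out.1 (by
      rw [hdisc]
      have := not_isSquare_fortySix_mul_sq (f := 2) two_ne_zero
      norm_num at this ⊢)
    have hd' := h.disc_eq.trans hdisc
    obtain ⟨x, y, hxy | hxy⟩ := exists_eval_eq_of_reduced hd' h₁ h₂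
    · exact ⟨true, properlyEquivalent_equivalence.trans h
        (properlyEquivalent_of_eval_eq hd' (by norm_num) hxy)⟩
    · exact ⟨false, properlyEquivalent_equivalence.trans h
        (properlyEquivalent_of_eval_eq hd' (by norm_num) hxy)⟩
  choose F hF using key
  have hinj : Function.Injective F := fun c c' h => by
    rw [← Quotient.out_eq c, ← Quotient.out_eq c']
    have h' := hF c'
    rw [← h] at h'
    exact Quotient.sound (properlyEquivalent_equivalence.trans (hF c)
      (properlyEquivalent_equivalence.symm h'))
  exact (Nat.card_le_card_of_injective F hinj).trans (by simp)

end BinaryForm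

/-! ### The Pell equation of `46` -/

namespace Pell.Solution₁

theorem x_pow_le_pow_x {d : ℤ} {a : Solution₁ d} (hd : 0 ≤ d) (hx : 0 < a.x) (hy : 0 < a.y)
    (n : ℕ) : a.x ^ n ≤ (a ^ n).x := by
  induction n with
  | zero => simp
  | succ n ih =>
    rw [pow_succ, pow_succ, x_mul]
    have hyn : 0 ≤ (a ^ n).y := by
      cases n with
      | zero => simp
      | succ n => exact (y_pow_succ_pos hx hy n).le
    have : 0 ≤ d * ((a ^ n).y * a.y) := mul_nonneg hd (mul_nonneg hyn hy.le)
    nlinarith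

/-- Modulo `p ∣ d`, `(x + y√d)^n ≡ x^n + n x^(n-1) y √d`; the factor `a.x` on the left avoids the
exponent `n - 1`. -/
theorem cast_pow_of_dvd {d : ℤ} {p : ℕ} (hp : (p : ℤ) ∣ d) (a : Solution₁ d) (n : ℕ) :
    ((a ^ n).x : ZMod p) = a.x ^ n ∧
      ((a ^ n).y : ZMod p) * a.x = n * a.x ^ n * a.y := by
  have hd : (d : ZMod p) = 0 := (ZMod.intCast_zmod_eq_zero_iff_dvd d p).mpr hp
  induction n with
  | zero => simp
  | succ n ih =>
    rw [pow_succ, x_mul, y_mul]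
    push_cast
    rw [hd, ih.1]
    refine ⟨by ring, ?_⟩
    linear_combination (a.x : ZMod p) * ih.2

/-- All solutions of `x² - 46 y² = 1` have `23 ∣ y`. -/
theorem dvd_y_of_fortySix (a : Solution₁ 46) : 23 ∣ a.y := by
  have h46 : (46 : ZMod 23) = 0 := by decide
  have h3588 : ((3588 : ℤ) : ZMod 23) = 0 := by decide
  have : Fact (Nat.Prime 23) := ⟨by norm_num⟩
  obtain ⟨a₁, h₁⟩ := IsFundamental.exists_of_not_isSquare (d := 46) (by norm_num)
    (by simpa using not_isSquare_fortySix_mul_sq one_ne_zero)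
  have hx0 : (a₁.x : ZMod 23) ≠ 0 := by
    intro h
    have := congrArg (Int.cast : ℤ → ZMod 23) a₁.prop
    push_cast at this
    rw [h, h46] at this
    simp at this
  have hy : (a₁.y : ZMod 23) = 0 := by
    -- Here `3588 = 23 · 156`. This solution need not be shown fundamental: as an `n`-th power it
    -- gives `23 ∣ n` or `23 ∣ a₁.y`, and `23 ∣ n` would make `x` at least `2^23 > 24335`.
    obtain ⟨n, hn⟩ := h₁.eq_pow_of_nonneg (a := mk 24335 3588 (by norm_num)) (by simp) (by simp)
    have hcast := (cast_pow_of_dvd (p := 23) (by norm_num) a₁ n).2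
    rw [← hn, y_mk, h3588, zero_mul] at hcast
    rcases mul_eq_zero.mp hcast.symm with h | h
    · have hn23 : 23 ∣ n := (ZMod.natCast_eq_zero_iff n 23).mp
        ((mul_eq_zero.mp h).resolve_right (pow_ne_zero n hx0))
      have hn0 : n ≠ 0 := by
        rintro rfl
        have := congrArg Solution₁.y hn
        simp at this
      have hle := x_pow_le_pow_x (by norm_num) h₁.x_pos h₁.2.1 n
      rw [← hn, x_mk] at hle
      have h2 : (2 : ℤ) ^ 23 ≤ a₁.x ^ n :=
        (pow_le_pow_left₀ (by norm_num) h₁.1 23).trans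
          (pow_le_pow_right₀ (by have := h₁.1; omega) (Nat.le_of_dvd (by omega) hn23))
      norm_num at h2
      omega
    · exact h
  have hpow : ∀ n : ℕ, ((a₁ ^ n).y : ZMod 23) = 0 := by
    intro n
    have h := (cast_pow_of_dvd (p := 23) (by norm_num) a₁ n).2
    rw [hy, mul_zero] at h
    exact (mul_eq_zero.mp h).resolve_right hx0
  have hzpow : ∀ n : ℤ, ((a₁ ^ n).y : ZMod 23) = 0 := by
    rintro (n | n)
    · simpa using hpow n
    · rw [zpow_negSucc, y_inv, Int.cast_neg, hpow, neg_zero]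
  have h0 : (a.y : ZMod 23) = 0 := by
    obtain ⟨n, rfl | rfl⟩ := h₁.eq_zpow_or_neg_zpow a
    · exact hzpow n
    · rw [y_neg, Int.cast_neg, hzpow, neg_zero]
  exact (ZMod.intCast_zmod_eq_zero_iff_dvd _ 23).mp h0

end Pell.Solution₁

theorem sq_sub_fortySix_mul_sq_ne_three {u w : ℤ} (hw : 23 ∣ w) : u ^ 2 - 46 * w ^ 2 ≠ 3 := by
  intro h
  wlog h3 : 3 ∣ u - w generalizing w
  · refine this (w := -w) (by simpa using hw) (by simpa using h) ?_
    have hdvd : (3 : ℤ) ∣ (u - w) * (u - -w) := ⟨1 + 15 * w ^ 2, by linear_combination h⟩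
    exact (Int.prime_three.dvd_or_dvd hdvd).resolve_left h3
  obtain ⟨k, hk⟩ := h3
  obtain rfl : u = w + 3 * k := by linarith
  -- This is the quotient of `u + w√46` by `7 + √46`, also of norm 3; it is integral because `3 ∣ u
  -- - w`. As 23 divides `w` and `2w - k`, it divides `u`, hence 3.
  have hy := (Pell.Solution₁.mk (d := 46) (7 * k - 13 * w) (2 * w - k) (by
    linarith)).dvd_y_of_fortySix
  rw [Pell.Solution₁.y_mk] at hy
  obtain ⟨w, rfl⟩ := hw
  obtain ⟨j, hj⟩ := hy
  obtain rfl : k = 23 * (2 * w - j) := by linarith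
  have h23 : (23 : ℤ) ∣ 3 :=
    ⟨23 * ((w + 3 * (2 * w - j)) ^ 2 - 46 * w ^ 2), by linear_combination -h⟩
  norm_num at h23

/-! ### Three classes of forms of discriminant `184 f²` -/

/-- Otherwise the squares would be closed under subtracting `c`; starting from 0 they would exhaust
`ZMod p`. -/
theorem exists_sq_sub_not_isSquare {p : ℕ} [Fact p.Prime] (hp : p ≠ 2) {c : ZMod p} (hc : c ≠ 0) :
    ∃ t : ZMod p, ¬ IsSquare (t ^ 2 - c) := by
  by_contra! h
  obtain ⟨a, ha⟩ := FiniteField.exists_nonsquare (F := ZMod p) (by rwa [ZMod.ringChar_zmod_n])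
  have hk : ∀ k : ℕ, IsSquare (-(k : ZMod p) * c) := by
    intro k
    induction k with
    | zero => simp
    | succ k ih =>
      obtain ⟨t, ht⟩ := ih
      convert h t using 1
      push_cast
      linear_combination ht
  obtain ⟨k, hk'⟩ := ZMod.natCast_zmod_surjective (-a / c)
  apply ha
  convert hk k using 1
  rw [hk']
  field_simp

theorem not_dvd_sq_sub_fortySix {t : ℤ} (ht : ¬ 23 ∣ t) : ¬ 23 ∣ t ^ 2 - 46 := fun h => by
  have h23 : Prime (23 : ℤ) := Int.prime_iff_natAbs_prime.mpr (by norm_num)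
  exact ht (h23.dvd_of_dvd_pow (n := 2) (by omega))

theorem two_lt_formClassNumber_of {f t : ℤ} (hf : f ≠ 0) (ht : ¬ 23 ∣ t)
    (hcop : IsCoprime (t ^ 2 - 46) f)
    (h : ∀ u v : ℤ, u ^ 2 - 46 * (f * v) ^ 2 ≠ t ^ 2 - 46) :
    2 < formClassNumber (184 * f ^ 2) := by
  -- Modulo 23 this would read `u² = -t²` with `t ≠ 0`.
  have hneg : ∀ u v : ℤ, u ^ 2 - 46 * (f * v) ^ 2 ≠ -(t ^ 2 - 46) := by
    intro u v huv
    have h' := congrArg (Int.cast : ℤ → ZMod 23) huv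
    have ht' : (t : ZMod 23) ≠ 0 := fun h0 => ht ((ZMod.intCast_zmod_eq_zero_iff_dvd t 23).mp h0)
    push_cast at h'
    rw [show (46 : ZMod 23) = 0 by decide, zero_mul, sub_zero, sub_zero] at h'
    revert h' ht'
    generalize (u : ZMod 23) = u, (t : ZMod 23) = t
    revert u t
    decide
  have hone : ∀ u v : ℤ, u ^ 2 - 46 * (f * v) ^ 2 ≠ -1 := by
    intro u v huv
    exact sq_sub_mul_sq_ne_neg_one f u v (by linear_combination huv)
  have := BinaryForm.finite_formClasses (d := 184 * f ^ 2) (by positivity) (by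
    have := not_isSquare_fortySix_mul_sq (f := 2 * f) (by positivity)
    rwa [show 46 * (2 * f) ^ 2 = 184 * f ^ 2 by ring] at this)
  let P : {Q : BinaryForm // Q.IsPrimitive ∧ Q.disc = 184 * f ^ 2} :=
    ⟨⟨1, 0, -46 * f ^ 2⟩, BinaryForm.isPrimitive_iff.mpr fun l hl _ _ => hl,
      by simp only [BinaryForm.disc]; ring⟩
  let M : {Q : BinaryForm // Q.IsPrimitive ∧ Q.disc = 184 * f ^ 2} :=
    ⟨⟨-1, 0, 46 * f ^ 2⟩, BinaryForm.isPrimitive_iff.mpr fun l hl _ _ => by simpa using hl,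
      by simp only [BinaryForm.disc]; ring⟩
  -- This is `(tx + fy)² - 46x²`, with value `t² - 46` at `(1, 0)`.
  let T : {Q : BinaryForm // Q.IsPrimitive ∧ Q.disc = 184 * f ^ 2} :=
    ⟨⟨t ^ 2 - 46, 2 * f * t, f ^ 2⟩, BinaryForm.isPrimitive_iff.mpr fun l hl _ hl' =>
        ((hcop.pow_right (n := 2)).isUnit_of_dvd' hl hl').dvd,
      by simp only [BinaryForm.disc]; ring⟩
  have hPM : ¬ P.1.ProperlyEquivalent M.1 := fun e => by
    obtain ⟨u, v, huv⟩ := e.exists_eval_eq 1 0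
    simp only [BinaryForm.eval, P, M] at huv
    exact hone u v (by linear_combination huv)
  have hPT : ¬ P.1.ProperlyEquivalent T.1 := fun e => by
    obtain ⟨u, v, huv⟩ := e.exists_eval_eq 1 0
    simp only [BinaryForm.eval, P, T] at huv
    exact h u v (by linear_combination huv)
  have hMT : ¬ M.1.ProperlyEquivalent T.1 := fun e => by
    obtain ⟨u, v, huv⟩ := e.exists_eval_eq 1 0
    simp only [BinaryForm.eval, M, T] at huv
    exact hneg u v (by linear_combination -huv)
  let := Fintype.ofFinite (Quotient (BinaryForm.formSetoid (184 * f ^ 2)))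
  rw [formClassNumber, Nat.card_eq_fintype_card, Fintype.two_lt_card_iff]
  exact ⟨Quotient.mk _ P, Quotient.mk _ M, Quotient.mk _ T, fun e => hPM (Quotient.exact e),
    fun e => hPT (Quotient.exact e), fun e => hMT (Quotient.exact e)⟩

/-! ### The choice of `t` for each conductor -/

theorem isCoprime_sq_sub_fortySix_self {t g : ℤ} (hg : Odd g) (h23 : ¬ 23 ∣ g) (ht : g ∣ t) :
    IsCoprime (t ^ 2 - 46) g := by
  have h46 : IsCoprime (46 : ℤ) g := by
    have h1 : IsCoprime (2 : ℤ) g := (Prime.coprime_iff_not_dvd Int.prime_two).mpr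
      (by rw [← even_iff_two_dvd, Int.not_even_iff_odd]; exact hg)
    have h2 : IsCoprime (23 : ℤ) g := (Prime.coprime_iff_not_dvd
      (Int.prime_iff_natAbs_prime.mpr (by norm_num))).mpr h23
    exact h1.mul_left h2
  obtain ⟨s, rfl⟩ := ht
  rw [show (g * s) ^ 2 - 46 = -46 + g * (g * s ^ 2) by ring]
  exact h46.neg_left.add_mul_left_left _

theorem isCoprime_sq_sub_fortySix_pow {t : ℤ} (ht : ¬ 23 ∣ t) (b : ℕ) :
    IsCoprime (t ^ 2 - 46) (23 ^ b) :=
  ((Prime.coprime_iff_not_dvd (Int.prime_iff_natAbs_prime.mpr (by norm_num))).mpr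
    (not_dvd_sq_sub_fortySix ht)).symm.pow_right

/-- For `t` the odd part of `m`, `t² - 46 ≡ 3` modulo 8, whereas `46 (fv)²` vanishes modulo 8 and 3
is not a square there. -/
theorem two_lt_formClassNumber_of_even {b m : ℕ} (h23 : ¬ 23 ∣ m) (hm : Even m) (hm0 : m ≠ 0) :
    2 < formClassNumber (184 * ((23 ^ b * m : ℕ) : ℤ) ^ 2) := by
  obtain ⟨a, g, hg, rfl⟩ := Nat.exists_eq_two_pow_mul_odd hm0
  have hg23 : ¬ (23 : ℤ) ∣ g := fun h => h23 (Dvd.dvd.mul_left (by exact_mod_cast h) _)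
  have hgo : Odd (g : ℤ) := by exact_mod_cast hg
  have hsq : (g : ℤ) ^ 2 % 8 = 1 := by
    rw [Int.odd_iff] at hgo
    have hg' : (g : ℤ) % 8 = 1 ∨ (g : ℤ) % 8 = 3 ∨ (g : ℤ) % 8 = 5 ∨ (g : ℤ) % 8 = 7 := by omega
    rcases hg' with h | h | h | h <;> simp [sq, Int.mul_emod, h]
  obtain ⟨e, he⟩ := hm
  refine two_lt_formClassNumber_of (t := g) (by positivity) hg23 ?_ fun u v h => ?_
  · push_cast
    refine (isCoprime_sq_sub_fortySix_pow hg23 b).mul_right (IsCoprime.mul_right ?_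
      (isCoprime_sq_sub_fortySix_self hgo hg23 dvd_rfl))
    exact ((Prime.coprime_iff_not_dvd Int.prime_two).mpr (by omega)).symm.pow_right
  · rw [he] at h
    push_cast at h
    have h8 : u ^ 2 = 8 * (23 * (23 ^ b * e * v) ^ 2) + (g : ℤ) ^ 2 - 46 := by
      linear_combination h
    have hu : u ^ 2 % 8 = 3 := by omega
    have hu' : u % 8 = 0 ∨ u % 8 = 1 ∨ u % 8 = 2 ∨ u % 8 = 3 ∨ u % 8 = 4 ∨ u % 8 = 5 ∨
      u % 8 = 6 ∨ u % 8 = 7 := by omega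
    rcases hu' with h | h | h | h | h | h | h | h <;> simp [sq, Int.mul_emod, h] at hu

/-- Modulo a prime `p ∣ m` the principal form takes only squares, so a `t` with `t² - 46` a
nonsquare modulo `p` suffices. -/
theorem two_lt_formClassNumber_of_odd {b m : ℕ} (h23 : ¬ 23 ∣ m) (hm : Odd m) (hm1 : m ≠ 1) :
    2 < formClassNumber (184 * ((23 ^ b * m : ℕ) : ℤ) ^ 2) := by
  obtain ⟨p, hp, hpm⟩ := Nat.exists_prime_and_dvd hm1
  have : Fact p.Prime := ⟨hp⟩
  have hp2 : p ≠ 2 := by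
    rintro rfl
    exact Nat.not_even_iff_odd.mpr hm (even_iff_two_dvd.mpr hpm)
  have hp23 : p ≠ 23 := by
    rintro rfl
    exact h23 hpm
  have hm0 : m ≠ 0 := by
    rintro rfl
    exact h23 (dvd_zero _)
  have h23p : (23 : ZMod p) ≠ 0 := by
    intro h
    have : p ∣ 23 := (ZMod.natCast_eq_zero_iff 23 p).mp (by exact_mod_cast h)
    exact hp23 ((Nat.prime_dvd_prime_iff_eq hp (by norm_num)).mp this)
  have h2p : (2 : ZMod p) ≠ 0 := by
    intro h
    have : p ∣ 2 := (ZMod.natCast_eq_zero_iff 2 p).mp (by exact_mod_cast h)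
    exact hp2 ((Nat.prime_dvd_prime_iff_eq hp (by norm_num)).mp this)
  obtain ⟨c, g, hpg, hmg⟩ := Nat.exists_eq_pow_mul_and_not_dvd hm0 p hp.ne_one
  have hgp : (g : ZMod p) ≠ 0 := fun h => hpg ((ZMod.natCast_eq_zero_iff g p).mp h)
  have hgo : Odd (g : ℤ) := by
    rw [hmg] at hm
    exact_mod_cast (Nat.odd_mul.mp hm).2
  have hg23 : ¬ (23 : ℤ) ∣ g := fun h => h23 (hmg ▸ Dvd.dvd.mul_left (by exact_mod_cast h) _)
  obtain ⟨t₀, ht₀⟩ := exists_sq_sub_not_isSquare hp2 (c := (46 : ZMod p)) (by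
    rw [show (46 : ZMod p) = 2 * 23 by norm_num]
    exact mul_ne_zero h2p h23p)
  -- `t = g(1 + 23k)` is a multiple of `g` (for coprimality), is `g` modulo 23, and is `t₀` modulo
  -- `p` by the choice of `k`.
  obtain ⟨k, hk⟩ := ZMod.intCast_surjective ((t₀ / (g : ZMod p) - 1) / 23)
  have ht : ((g * (1 + 23 * k) : ℤ) : ZMod p) = t₀ := by
    push_cast
    rw [hk]
    field_simp
    ring
  have htsq : ¬ IsSquare (((((g : ℤ) * (1 + 23 * k)) ^ 2 - 46 : ℤ) : ZMod p)) := by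
    rw [Int.cast_sub, Int.cast_pow, ht]
    exact_mod_cast ht₀
  have ht23 : ¬ (23 : ℤ) ∣ g * (1 + 23 * k) := fun h => by
    rcases (Int.prime_iff_natAbs_prime.mpr (by norm_num) : Prime (23 : ℤ)).dvd_or_dvd h with h | h
    · exact hg23 h
    · omega
  refine two_lt_formClassNumber_of (t := g * (1 + 23 * k)) (by positivity) ht23 ?_ fun u v h => ?_
  · rw [hmg]
    push_cast
    refine (isCoprime_sq_sub_fortySix_pow ht23 b).mul_right (IsCoprime.mul_right ?_
      (isCoprime_sq_sub_fortySix_self hgo hg23 (dvd_mul_right _ _)))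
    refine ((Prime.coprime_iff_not_dvd (Nat.prime_iff_prime_int.mp hp)).mpr
      fun hdvd => htsq ?_).symm.pow_right
    rw [(ZMod.intCast_zmod_eq_zero_iff_dvd _ p).mpr hdvd]
    exact IsSquare.zero
  · apply htsq
    rw [← h]
    refine ⟨u, ?_⟩
    have hmp : (m : ZMod p) = 0 := (ZMod.natCast_eq_zero_iff m p).mpr hpm
    push_cast
    rw [hmp]
    ring

/-- With `t = 7` the value is 3, a square modulo 23, so that congruence gives no obstruction and the
Pell argument is used. -/
theorem two_lt_formClassNumber_of_pow {b : ℕ} (hb : b ≠ 0) :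
    2 < formClassNumber (184 * ((23 ^ b : ℕ) : ℤ) ^ 2) := by
  have h7 : ¬ (23 : ℤ) ∣ 7 := by norm_num
  refine two_lt_formClassNumber_of (t := 7) (by positivity) h7 ?_ fun u v h => ?_
  · push_cast
    exact isCoprime_sq_sub_fortySix_pow h7 b
  · refine sq_sub_fortySix_mul_sq_ne_three (u := u) (Dvd.dvd.mul_right ?_ v) (h.trans (by norm_num))
    push_cast
    exact dvd_pow_self _ hb

theorem two_lt_formClassNumber {f : ℕ} (hf : 1 < f) :
    2 < formClassNumber (184 * (f : ℤ) ^ 2) := by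
  obtain ⟨b, m, h23, rfl⟩ :=
    Nat.exists_eq_pow_mul_and_not_dvd (show f ≠ 0 by omega) 23 (by norm_num)
  rcases Nat.even_or_odd m with hm | hm
  · exact two_lt_formClassNumber_of_even h23 hm (by rintro rfl; exact h23 (dvd_zero _))
  · by_cases hm1 : m = 1
    · subst hm1
      rw [mul_one]
      exact two_lt_formClassNumber_of_pow (by rintro rfl; simp at hf)
    · exact two_lt_formClassNumber_of_odd h23 hm hm1

theorem theorem1p1 (f : ℕ) (hf : 1 < f) :
    relIdealClassNumber 184 f = relStrictIdealClassNumber 184 f ∧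
      relStrictIdealClassNumber 184 f = relFormClassNumber 184 f ∧
      1 < relIdealClassNumber 184 f := by
  have hf0 : f ≠ 0 := by omega
  have e₁ := strictIdealClassNumber_184_eq_two_mul hf0
  have e₂ := strictIdealClassNumber_184_eq_two_mul one_ne_zero
  have e₃ := strictIdealClassNumber_184_eq_formClassNumber hf0
  have e₄ := strictIdealClassNumber_184_eq_formClassNumber one_ne_zero
  rw [Nat.cast_one, one_pow, mul_one] at e₄
  have hlt := two_lt_formClassNumber hf
  have hle := BinaryForm.formClassNumber_184_le_two
  -- Division by zero gives zero in ℚ, so the strict inequality needs `h(184) ≠ 0`.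
  have hpos : 0 < formClassNumber 184 := by
    have := BinaryForm.finite_formClasses (d := 184) (by norm_num) (by
      simpa using not_isSquare_fortySix_mul_sq (f := 2) two_ne_zero)
    have : Nonempty (Quotient (BinaryForm.formSetoid 184)) :=
      ⟨Quotient.mk _ ⟨⟨1, 0, -46⟩, BinaryForm.isPrimitive_iff.mpr fun l hl _ _ => hl, by
        norm_num [BinaryForm.disc]⟩⟩
    exact Nat.card_pos
  refine ⟨?_, ?_, ?_⟩
  · rw [relIdealClassNumber, relStrictIdealClassNumber, e₁, e₂]
    push_cast
    rw [mul_div_mul_left _ _ two_ne_zero]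
  · rw [relStrictIdealClassNumber, relFormClassNumber, e₃, e₄]
    norm_cast
  · rw [relIdealClassNumber, one_lt_div (by norm_cast; omega)]
    norm_cast
    omega
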